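/- Let $F=\mathbb F_q$ be a finite field, $n\ge 0$, $V=F^n$ (row vectors) and $M\in F^{n\times n}$. Costs count elementary field operations (additions, subtractions, multiplications and divisions of two field elements); comparisons and movement of data are free. \emph{CharPoly.} Starting with the empty list of rows, as long as fewer than $n$ rows have been found, the $i$-th round picks a random vector $v^{(i)}$ outside the span $W_{i-1}$ of the rows found so far (a random element of $W_{i-1}$ plus a random non-zero vector of a complement of $W_{i-1}$), and spins it up: $v^{(i)},v^{(i)}M,v^{(i)}M^2,\dots$ are reduced one after the other by semi-echelon elimination and appended to the rows until $v^{(i)}M^{d_i}$ depends linearly on the rows found so far. This yields the relative order polynomial $p^{(i)}=\mathrm{ord}_M(v^{(i)}+W_{i-1})$ of degree $d_i$ and the coordinate vector $b^{(i)}$ of $v^{(i)}M^{d_i}$ with respect to the rows. Let $k$ be the number of rounds, $Y$ the invertible matrix of all rows, $M'=YMY^{-1}$, $s_i=d_1+\dots+d_i$, $W'_i=\langle e^{(1)},\dots,e^{(s_i)}\rangle$. The matrix $M'$ is block lower triangular, all its rows being unit vectors (shifts) except the last row of the $i$-th block, which is $b^{(i)}$. \emph{OrdPoly}$(z,v)$,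 for $v\in W'_z$: for $i=z,z-1,\dots,1$ let $h=\sum_{j=1}^{d_i}v_{s_{i-1}+j}x^{j-1}$; if $h\ne0$, compute $g=p^{(i)}/\gcd(h,p^{(i)})$ in factorised form, record it, and, if $i>1$, replace $v$ by $v\,g(M')$. The product of the recorded polynomials is $\mathrm{ord}_{M'}(v)$. \emph{MinPolyMC} runs CharPoly on $M$, factorises all $p^{(j)}$ into irreducibles, puts $f:=\mathrm{lcm}(p^{(1)},\dots,p^{(k)})$ and, for $i=2,\dots,u$, replaces $f$ by $\mathrm{lcm}(f,\mathrm{OrdPoly}(i,e^{(s_{i-1}+1)}))$, where in the original algorithm $u$ is the minimum of $k$ and the least $u$ with $\sum_r q^{-u\deg q_r}\le\varepsilon$, the sum being over the distinct irreducible factors $q_r$ of the $p^{(j)}$. It returns $(\mathrm{True},f)$ if $u=k$ or $\deg f=n$, and $(\mathrm{Uncertain},f)$ otherwise. The polynomial $f$ is kept in factorised form, so products and least common multiples of factorised polynomials are formed on multiplicities and cost no field operations. The modified algorithm uses $u=k$, that is, its for-loop runs over $i=2,\dots,k$. Let $\mathrm{char}(n,q)$ be an upper bound for the cost of CharPoly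 on $n\times n$ matrices over $\mathbb F_q$ (including whatever is charged for the random vectors), and let $\mathrm{fact}(n,q)$ be an upper bound for the cost, by the factorisation routine in use, of factorising any monic non-constant polynomials over $\mathbb F_q$ whose degrees sum to $n$; this routine is assumed to be correct. \textbf{Proposition.} For every outcome of the random choices with $k\le\sqrt n$, the modified algorithm returns $(\mathrm{True},\mu_M)$, where $\mu_M$ is the minimal polynomial of $M$, and its overall cost is at most \[\mathrm{char}(n,q)+\mathrm{fact}(n,q)+\tfrac14n^3+\tfrac{37}{4}n^{5/2}\] elementary field operations. -/

import Mathlib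

open Polynomial

noncomputable section

namespace MinPolyMC

universe u

/-! ## Counting elementary field operations -/

/-- A computation: its result together with the number of elementary field operations
(additions, subtractions, multiplications, divisions of two field elements) it performed.
Comparisons of field elements, index bookkeeping and moving data are free. -/
@[ext] structure Cost (α : Type u) : Type u where
  val : α
  cost : ℕ

/-- Sequential composition adds up the costs. -/
instance : Monad Cost where
  pure a := ⟨a, 0⟩
  bind x f := ⟨(f x.val).val, x.cost + (f x.val).cost⟩

/-- Charge `c` operations. -/
def charge (c : ℕ) : Cost PUnit.{u + 1} := ⟨PUnit.unit, c⟩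

/-- Run the computations `f i` one after the other and collect their results. -/
def tab {α : Type u} {m : ℕ} (f : Fin m → Cost α) : Cost (Fin m → α) :=
  ⟨fun i => (f i).val, ∑ i, (f i).cost⟩

variable {F : Type u} [Field F]

/-- The four elementary field operations. Each of `add`, `sub`, `mul` and `div` costs one. -/
def add (x y : F) : Cost F := ⟨x + y, 1⟩
def sub (x y : F) : Cost F := ⟨x - y, 1⟩
def mul (x y : F) : Cost F := ⟨x * y, 1⟩
def div (x y : F) : Cost F := ⟨x / y, 1⟩

/-- Run `f 0, …, f (m - 1)` and collect their results in a sequence that vanishes from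
position `m` on. -/
def tabUpTo (m : ℕ) (f : ℕ → Cost F) : Cost (ℕ → F) :=
  ⟨fun j => if j < m then (f j).val else 0, ∑ j ∈ Finset.range m, (f j).cost⟩

/-- `x + a * y`, two operations. -/
def addMul (x a y : F) : Cost F := do
  let t ← mul a y
  add x t

/-- `x - a * y`, two operations. -/
def subMul (x a y : F) : Cost F := do
  let t ← mul a y
  sub x t

/-- `x₀ + ∑ i ∈ l, a i * y i`, accumulated from left to right. -/
def dotFrom {ι : Type} (x₀ : F) (l : List ι) (a y : ι → F) : Cost F :=
  l.foldlM (fun acc i => addMul acc (a i) (y i)) x₀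

/-- Row vector times square matrix. -/
def vecMul {n : ℕ} (v : Fin n → F) (M : Matrix (Fin n) (Fin n) F) : Cost (Fin n → F) :=
  tab fun j => dotFrom 0 (List.finRange n) v (fun i => M i j)

/-- Row vector times lower triangular matrix: only the entries `T i c` with `c ≤ i` are used. -/
def vecMulLower {m : ℕ} (a : Fin m → F) (T : Matrix (Fin m) (Fin m) F) : Cost (Fin m → F) :=
  tab fun c => dotFrom 0 ((List.finRange m).filter (fun i => c ≤ i)) a (fun i => T i c)

/-! ## Semi echelon data sequences, relative order polynomials -/

/-- The data `(Y, S, T, l)` of a semi echelon data sequence, `len` being the number of rows. The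
algorithms below start from the trivial one and maintain `T * Y = S`, with `T` lower triangular
and invertible and `S` in row semi echelon form with leading columns `lc`. -/
structure SemiEchelon (F : Type u) (n : ℕ) : Type u where
  len : ℕ
  Y : Matrix (Fin len) (Fin n) F
  S : Matrix (Fin len) (Fin n) F
  T : Matrix (Fin len) (Fin len) F
  lc : Fin len → Fin n

/-- The trivial semi echelon data sequence. -/
def SemiEchelon.trivial (F : Type u) (n : ℕ) : SemiEchelon F n where
  len := 0
  Y := Fin.elim0
  S := Fin.elim0
  T := Fin.elim0
  lc := Fin.elim0

/-- The loop of `cleanAndExtend`: for each row `i` in turn, `a i := w (lc i)` and then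
`w := w - a i • S i`, starting from `w = v`. Returns `(a, w)`. -/
def clean {n : ℕ} (E : SemiEchelon F n) (v : Fin n → F) :
    Cost ((Fin E.len → F) × (Fin n → F)) :=
  (List.finRange E.len).foldlM
    (fun aw i => do
      let c := aw.2 (E.lc i)
      let w ← tab fun j => subMul (aw.2 j) c (E.S i j)
      pure (Function.update aw.1 i c, w))
    ((fun _ => 0), v)

/-- Algorithm CleanAndExtend. Returns `(c, Y', a')`, where `c` tells whether `v` is in the row
space; if it is not, the data sequence is extended by the row `v`. -/
def cleanAndExtend [DecidableEq F] {n : ℕ} (E : SemiEchelon F n) (v : Fin n → F) :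
    Cost (Bool × (Σ E' : SemiEchelon F n, (Fin E'.len → F))) := do
  let aw ← clean E v
  let a := aw.1
  let w := aw.2
  match (List.finRange n).find? (fun j => w j ≠ 0) with
  | none => pure (true, ⟨E, a⟩)
  | some j => do
    let x ← div 1 (w j)
    let aT ← vecMulLower a E.T
    let y ← sub 0 x
    let t ← tab fun c => mul y (aT c)
    let s ← tab fun c => mul x (w c)
    pure (false,
      ⟨{ len := E.len + 1
         Y := Fin.snoc (α := fun _ => Fin n → F) E.Y v
         S := Fin.snoc (α := fun _ => Fin n → F) E.S s
         T := Fin.snoc (α := fun _ => Fin (E.len + 1) → F)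
           (fun i => Fin.snoc (α := fun _ => F) (E.T i) 0) (Fin.snoc (α := fun _ => F) t x)
         lc := Fin.snoc (α := fun _ => Fin n) E.lc j },
       Fin.snoc (α := fun _ => F) a (w j)⟩)

/-- The loop of `relativeOrdPoly`. The first argument bounds the number of rounds; as every
unsuccessful round adds a linearly independent row, `n + 1` rounds always suffice. -/
def relativeOrdPolyLoop [DecidableEq F] {n : ℕ} (M : Matrix (Fin n) (Fin n) F) :
    ℕ → SemiEchelon F n → (Fin n → F) → Cost (Σ E' : SemiEchelon F n, (Fin E'.len → F))
  | 0, E, _ => pure ⟨E, fun _ => 0⟩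
  | r + 1, E, v => do
    let res ← cleanAndExtend E v
    if res.1 then
      pure res.2
    else do
      let v' ← vecMul v M
      relativeOrdPolyLoop M r res.2.1 v'

/-- A relative order polynomial `p = ord_M(v + W)` of degree `d`, together with the coordinates
`b` of `v M ^ d` with respect to the rows of `Y` (numbered from 0, padded by zeros). -/
structure Block (F : Type u) [Field F] : Type u where
  p : F[X]
  b : ℕ → F

/-- Algorithm RelativeOrdPoly. -/
def relativeOrdPoly [DecidableEq F] {n : ℕ} (E : SemiEchelon F n) (v : Fin n → F)
    (M : Matrix (Fin n) (Fin n) F) : Cost (Block F × SemiEchelon F n) := do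
  let r ← relativeOrdPolyLoop M (n + 1) E v
  let E' := r.1
  let d := E'.len - E.len
  let b' ← vecMulLower r.2 E'.T
  let b : ℕ → F := fun j => if h : j < E'.len then b' ⟨j, h⟩ else 0
  let c ← tabUpTo d fun i => sub 0 (b (E.len + i))
  pure (⟨X ^ d + ∑ i ∈ Finset.range d, C (c i) * X ^ i, b⟩, E')

/-! ## The characteristic polynomial -/

/-- One possible outcome of all calls of RandomVector and RandomVector*: in round `i`, `vec i m`
is the vector obtained from `F ^ m`, and `vecStar i m lc` is the one obtained from
`V(lc) = {v | v (lc r) = 0 for all r}`, which is non-zero as soon as some column is missing from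
`lc`. -/
structure RandomOutcome (F : Type u) [Field F] (n : ℕ) : Type u where
  vec : ℕ → (m : ℕ) → (Fin m → F)
  vecStar : ℕ → (m : ℕ) → (Fin m → Fin n) → (Fin n → F)
  vecStar_mem : ∀ i m (lc : Fin m → Fin n) r, vecStar i m lc (lc r) = 0
  vecStar_ne_zero : ∀ i m (lc : Fin m → Fin n), (∃ j, ∀ r, lc r ≠ j) → vecStar i m lc ≠ 0

/-- The while loop of `charPoly`. The first argument bounds the number of rounds; as every round
increases the length of the data sequence, `n` rounds always suffice. A random vector from an
`r`-dimensional space is charged `ξ r`. -/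
def charPolyLoop [DecidableEq F] {n : ℕ} (ξ : ℕ → ℕ) (ω : RandomOutcome F n)
    (M : Matrix (Fin n) (Fin n) F) :
    ℕ → ℕ → SemiEchelon F n → List (Block F) → Cost (List (Block F) × SemiEchelon F n)
  | 0, _, E, bs => pure (bs, E)
  | r + 1, i, E, bs =>
    if E.len < n then do
      charge (ξ E.len)
      let a := ω.vec i E.len
      charge (ξ (n - E.len))
      let c := ω.vecStar i E.len E.lc
      let v ← tab fun j => dotFrom (c j) (List.finRange E.len) a (fun r => E.S r j)
      let res ← relativeOrdPoly E v M
      charPolyLoop ξ ω M r (i + 1) res.2 (bs ++ [res.1])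
    else
      pure (bs, E)

/-- Algorithm CharPoly. The number `k` of cyclic subspaces is the length of the list of blocks. -/
def charPoly [DecidableEq F] {n : ℕ} (ξ : ℕ → ℕ) (ω : RandomOutcome F n)
    (M : Matrix (Fin n) (Fin n) F) : Cost (List (Block F) × SemiEchelon F n) :=
  charPolyLoop ξ ω M n 1 (SemiEchelon.trivial F n) []

/-! ## Factorised polynomials -/

/-- A polynomial in factorised form: the multiplicity of each irreducible factor. Products, least
common multiples and degrees of factorised polynomials need no field operations. -/
abbrev Factorised (F : Type u) [Field F] : Type u := F[X] →₀ ℕ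

/-- The polynomial that a factorised polynomial stands for. -/
def Factorised.value (f : Factorised F) : F[X] := f.prod fun q e => q ^ e

/-- Its degree, read off the multiplicities. -/
def Factorised.deg (f : Factorised F) : ℕ := f.sum fun q e => e * q.natDegree

/-- `f` is the factorisation of the monic polynomial `p` into monic irreducibles. -/
def IsFactorisation (p : F[X]) (f : Factorised F) : Prop :=
  (∀ q ∈ f.support, q.Monic ∧ Irreducible q) ∧ f.value = p

/-- Least common multiple: the maximum of the multiplicities. -/
def Factorised.lcm (f g : Factorised F) : Factorised F := f ⊔ g

/-- Division by the monic polynomial `q` of degree `b`, in place, of the polynomial with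
coefficients `h 0, …, h (b + r - 1)`: afterwards positions `0, …, b - 1` hold the remainder and
positions `b, …, b + r - 1` the quotient. -/
def divInPlace (q : F[X]) : ℕ → (ℕ → F) → Cost (ℕ → F)
  | 0, h => pure h
  | r + 1, h => do
    let c := h (r + q.natDegree)
    let t ← tabUpTo q.natDegree fun j => subMul (h (r + j)) c (q.coeff j)
    divInPlace q r
      (fun j => if r ≤ j ∧ j < r + q.natDegree then t (j - r) else h j)

/-- The exponent of the irreducible `q` in `gcd(h, q ^ e)`, found by at most `e` trial divisions,
together with the remaining cofactor of `h`. The polynomial `h` is given by its coefficients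
`h 0, …, h (L - 1)`. -/
def gcdExponent [DecidableEq F] (q : F[X]) : ℕ → ℕ → (ℕ → F) → Cost (ℕ × (ℕ → F))
  | 0, _, h => pure (0, h)
  | e + 1, L, h => do
    let r ← divInPlace q (L - q.natDegree) h
    if ∀ j < q.natDegree, r j = 0 then do
      let res ← gcdExponent q e (L - q.natDegree) (fun j => r (j + q.natDegree))
      pure (res.1 + 1, res.2)
    else
      pure (0, h)

/-- `p / gcd(h, p)` in factorised form, for `p` in factorised form and `h ≠ 0` given by its
coefficients `h 0, …, h (L - 1)`. -/
def divGcd [DecidableEq F] (p : Factorised F) (L : ℕ) (h : ℕ → F) : Cost (Factorised F) :=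
  p.support.toList.foldlM
    (fun g q => do
      let res ← gcdExponent q (p q) L h
      pure (g + Finsupp.single q (p q - res.1)))
    0

/-! ## Absolute order polynomials with respect to `M' = Y M Y⁻¹` -/

/-- `blockEnd bs i = d₁ + ⋯ + dᵢ`, the sum of the degrees of the first `i` polynomials. -/
def blockEnd (bs : List (Block F)) (i : ℕ) : ℕ :=
  ((bs.take i).map fun B => B.p.natDegree).sum

/-- `w ↦ w M'` for `w` in `W'_z`, that is, with support in the first `s = blockEnd bs z`
coordinates (numbered from 0). The last row of `M'` in each block is the vector `b` of the
block, all other rows only shift; so a shift is followed by adding multiples of the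
(possibly non-zero parts of the) vectors `b`. -/
def mulM' (bs : List (Block F)) (z : ℕ) (w : ℕ → F) : Cost (ℕ → F) :=
  (bs.take z).zipIdx.foldlM
    (fun y Br => do
      let s := blockEnd bs (Br.2 + 1)
      let t ← tabUpTo s fun j => addMul (y j) (w (s - 1)) (Br.1.b j)
      pure fun j => if j < s then t j else y j)
    (fun j => if j < blockEnd bs z ∧ ∀ i ≤ z, j ≠ blockEnd bs i then w (j - 1) else 0)

/-- Loop of `applyPoly`: `w` is multiplied by `M'` and a multiple of it is added to `y`, for each
of the given coefficients in turn. -/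
def applyPolyLoop (bs : List (Block F)) (z : ℕ) :
    List F → (ℕ → F) → (ℕ → F) → Cost (ℕ → F)
  | [], _, y => pure y
  | c :: cs, w, y => do
    let w' ← mulM' bs z w
    let y' ← tabUpTo (blockEnd bs z) fun j => addMul (y j) c (w' j)
    applyPolyLoop bs z cs w' y'

/-- `w ↦ w q(M')` for `w` in `W'_z`. -/
def applyPoly (bs : List (Block F)) (z : ℕ) (q : F[X]) (w : ℕ → F) : Cost (ℕ → F) := do
  let y ← tabUpTo (blockEnd bs z) fun j => mul (q.coeff 0) (w j)
  applyPolyLoop bs z ((List.range q.natDegree).map fun r => q.coeff (r + 1)) w y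

/-- `w ↦ w g(M')` for `w` in `W'_z` and `g` in factorised form, one irreducible factor after the
other. -/
def applyFactorised (bs : List (Block F)) (z : ℕ) (g : Factorised F) (w : ℕ → F) :
    Cost (ℕ → F) :=
  (g.support.toList.flatMap fun q => List.replicate (g q) q).foldlM
    (fun w q => applyPoly bs z q w) w

/-- Algorithm OrdPoly for `v` in `W'_z`: a list of factorised polynomials the product of which is
the order polynomial of `v` with respect to `M'`. The `i`-th entry of `fs` is the
factorisation of the polynomial of the `i`-th block. -/
def ordPoly [DecidableEq F] (bs : List (Block F)) (fs : List (Factorised F)) :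
    ℕ → (ℕ → F) → Cost (List (Factorised F))
  | 0, _ => pure []
  | i + 1, v => do
    let s := blockEnd bs i
    let d := blockEnd bs (i + 1) - s
    let h : ℕ → F := fun j => if j < d then v (s + j) else 0
    if ∀ j < d, h j = 0 then
      ordPoly bs fs i v
    else do
      let g ← divGcd (fs.getD i 0) d h
      let v' ← if 0 < i then applyFactorised bs (i + 1) g v else pure v
      let f ← ordPoly bs fs i v'
      pure (g :: f)

/-! ## The minimal polynomial -/

/-- Algorithm MinPolyMC, with the upper end `u` of its for loop (`i = 2, …, u`) computed by
`loopEnd` from `k` and the factorisations of the `k` polynomials. The final polynomial is returned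
in factorised form. `factorise` is the routine that factorises a list of polynomials. -/
def minPolyWith [DecidableEq F] {n : ℕ} (loopEnd : ℕ → List (Factorised F) → ℕ)
    (factorise : List F[X] → Cost (List (Factorised F))) (ξ : ℕ → ℕ) (ω : RandomOutcome F n)
    (M : Matrix (Fin n) (Fin n) F) : Cost (Bool × Factorised F) := do
  let res ← charPoly ξ ω M
  let bs := res.1
  let k := bs.length
  let fs ← factorise (bs.map fun B => B.p)
  let u := loopEnd k fs
  let f ← (List.range' 2 (u - 1)).foldlM
    (fun f i => do
      let g ← ordPoly bs fs i (fun j => if j = blockEnd bs (i - 1) then 1 else 0)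
      pure (f.lcm g.sum))
    (fs.foldr Factorised.lcm 0)
  pure (decide (u = k ∨ f.deg = n), f)

/-- The original loop end: the minimum of `k` and the least `u` with
`∑ q ^ (-u deg q_r) ≤ ε`, where the `q_r` are the irreducible factors and `q = |F|`. -/
def monteCarloLoopEnd [Fintype F] (ε : ℝ) (k : ℕ) (fs : List (Factorised F)) : ℕ :=
  min (sInf {u : ℕ | ∑ p ∈ (fs.foldr Factorised.lcm 0).support,
    ((Fintype.card F : ℝ) ^ (u * p.natDegree))⁻¹ ≤ ε}) k

/-- Algorithm MinPolyMC with error bound `ε`. -/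
def minPolyMC [Fintype F] [DecidableEq F] {n : ℕ} (ε : ℝ) :
    (List F[X] → Cost (List (Factorised F))) → (ℕ → ℕ) → RandomOutcome F n →
      Matrix (Fin n) (Fin n) F → Cost (Bool × Factorised F) :=
  minPolyWith (monteCarloLoopEnd ε)

/-- Algorithm MinPolyMC modified so that the for loop is run up to `k`. -/
def minPolyFull [DecidableEq F] {n : ℕ} :
    (List F[X] → Cost (List (Factorised F))) → (ℕ → ℕ) → RandomOutcome F n →
      Matrix (Fin n) (Fin n) F → Cost (Bool × Factorised F) :=
  minPolyWith fun k _ => k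

/-- The factorisation routine is correct on all lists of monic non-constant polynomials. -/
def FactorisesCorrectly (factorise : List F[X] → Cost (List (Factorised F))) : Prop :=
  ∀ ps : List F[X], (∀ p ∈ ps, p.Monic ∧ 0 < p.natDegree) →
    List.Forall₂ IsFactorisation ps (factorise ps).val

/-- `c` bounds the cost of factorising any monic non-constant polynomials whose degrees sum to
`n`. -/
def IsFactBound (factorise : List F[X] → Cost (List (Factorised F))) (n : ℕ) (c : ℝ) : Prop :=
  ∀ ps : List F[X], (∀ p ∈ ps, p.Monic ∧ 0 < p.natDegree) → (ps.map natDegree).sum = n →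
    ((factorise ps).cost : ℝ) ≤ c

/-- `c` bounds the cost of CharPoly on all `n × n` matrices over `F`, for all outcomes of the random
choices. -/
def IsCharBound (F : Type u) [Field F] [DecidableEq F] (n : ℕ) (ξ : ℕ → ℕ) (c : ℝ) : Prop :=
  ∀ (M : Matrix (Fin n) (Fin n) F) (ω : RandomOutcome F n), ((charPoly ξ ω M).cost : ℝ) ≤ c

end MinPolyMC

end

/-!
Everything is computed in the coordinates with respect to the rows `Y j` that `charPoly` finds;
they form a basis of `F ^ n` (`charPoly_spec`), and `comb Y m w` denotes the vector with
coordinates `w`. The span `W i` of the rows of the first `i` blocks is invariant under `M`, and the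
polynomial `p i` of block `i` is the relative order polynomial of its first vector `y i`: a
polynomial `u` in `M` maps `y i` into the span of the earlier rows if and only if `p i ∣ u`
(`CyclicBasis.vecMul_aeval_mem_iff`). This holds because `p i` itself does, and because the
remainder of `u` modulo `p i` maps `y i` to a combination of the rows of the block.

A vector in `W i` is congruent to `y i * h(M)` modulo `W (i - 1)`, so `u` maps it into `W (i - 1)`
if and only if `p i ∣ u * h`, that is, if and only if `g = p i / gcd(h, p i)` divides `u`
(`value_divGcd_dvd_iff`). Descending through the blocks shows that the product of the polynomials
`g` is the order polynomial (`CyclicBasis.ordPoly_spec`). A polynomial annihilates `M` if and only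
if it annihilates all `y i`, so the least common multiple of the `p i` and of the order polynomials
of `y 2, …, y k` divides the same polynomials as the minimal polynomial (`value_minPoly`).

For the cost, let `d i` be the degrees and `s i` the block ends. A step of `ordPoly` for block `i`
costs at most `2 (d i) ^ 2` for the trial divisions and `d i * (3 s i + 2 ∑_{j ≤ i} s j)` for
applying `g`, a polynomial of degree at most `d i` (`cost_ordPoly_le`). It is carried out in at
most `k - i + 1` of the `k - 1` calls. The summands with `j < i` amount to at most
`(k - i + 1) (i - 1) * 2 * d i * s (i - 1)`; as `(k - i + 1) (i - 1) ≤ k ^ 2 / 4` and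
`∑ 2 * d i * s (i - 1) ≤ n ^ 2`, these give `k ^ 2 * n ^ 2 / 4 ≤ n ^ 3 / 4`. All other
contributions are bounded by `7 k n ^ 2 ≤ 7 n ^ (5 / 2)` (`sum_stepCost_le`).
-/

noncomputable section

namespace MinPolyMC

universe u

variable {F : Type u} [Field F]

/-! ### Values and costs of composed computations -/

@[simp] theorem val_pure {α : Type u} (a : α) : (pure a : Cost α).val = a := rfl

@[simp] theorem cost_pure {α : Type u} (a : α) : (pure a : Cost α).cost = 0 := rfl

@[simp] theorem val_bind {α β : Type u} (x : Cost α) (f : α → Cost β) :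
    (x >>= f).val = (f x.val).val := rfl

@[simp] theorem cost_bind {α β : Type u} (x : Cost α) (f : α → Cost β) :
    (x >>= f).cost = x.cost + (f x.val).cost := rfl

theorem val_foldlM {α : Type u} {ι : Type*} (f : α → ι → Cost α) (l : List ι) (a : α) :
    (l.foldlM f a).val = l.foldl (fun x i => (f x i).val) a := by
  induction l generalizing a with
  | nil => rfl
  | cons i l ih => simp [ih]

theorem cost_foldlM_le {α : Type u} {ι : Type*} (f : α → ι → Cost α) (c : ι → ℕ) (l : List ι)
    (h : ∀ i ∈ l, ∀ x, (f x i).cost ≤ c i) (a : α) :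
    (l.foldlM f a).cost ≤ (l.map c).sum := by
  induction l generalizing a with
  | nil => simp
  | cons i l ih =>
    simp only [List.foldlM_cons, cost_bind, List.map_cons, List.sum_cons]
    exact Nat.add_le_add (h i (by simp) a) (ih (fun j hj => h j (by simp [hj])) _)

/-- Induction along a loop over `0, …, m - 1`; `P i` holds before round `i`. -/
theorem foldl_finRange_induction {α : Type*} {m : ℕ} (f : α → Fin m → α) (P : ℕ → α → Prop)
    (a : α) (h0 : P 0 a) (hs : ∀ (i : Fin m) x, P i x → P (i + 1) (f x i)) :
    P m ((List.finRange m).foldl f a) := by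
  suffices H : ∀ (l pre : List (Fin m)), pre ++ l = List.finRange m → ∀ x, P pre.length x →
      P m (l.foldl f x) from H _ [] rfl a h0
  intro l
  induction l with
  | nil =>
    intro pre hpre x hx
    have : pre.length = m := by simpa using congrArg List.length hpre
    simpa [this] using hx
  | cons i l ih =>
    intro pre hpre x hx
    have hi : (i : ℕ) = pre.length := by
      have h1 : (List.finRange m)[pre.length]? = some i := by rw [← hpre]; simp
      obtain ⟨hlt, h2⟩ := List.getElem?_eq_some_iff.1 h1
      rw [← h2]; simp
    have := ih (pre ++ [i]) (by simpa using hpre) (f x i)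
      (by simpa [← hi] using hs i x (hi ▸ hx))
    simpa using this

@[simp] theorem val_sub (x y : F) : (sub x y).val = x - y := rfl
@[simp] theorem val_mul (x y : F) : (mul x y).val = x * y := rfl
@[simp] theorem val_div (x y : F) : (div x y).val = x / y := rfl
@[simp] theorem val_addMul (x a y : F) : (addMul x a y).val = x + a * y := rfl
@[simp] theorem val_subMul (x a y : F) : (subMul x a y).val = x - a * y := rfl

@[simp] theorem cost_mul (x y : F) : (mul x y).cost = 1 := rfl
@[simp] theorem cost_addMul (x a y : F) : (addMul x a y).cost = 2 := rfl
@[simp] theorem cost_subMul (x a y : F) : (subMul x a y).cost = 2 := rfl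

@[simp] theorem val_tab {α : Type u} {m : ℕ} (f : Fin m → Cost α) (i : Fin m) :
    (tab f).val i = (f i).val := rfl

@[simp] theorem val_tabUpTo (m : ℕ) (f : ℕ → Cost F) (j : ℕ) :
    (tabUpTo m f).val j = if j < m then (f j).val else 0 := rfl

@[simp] theorem cost_tabUpTo (m : ℕ) (f : ℕ → Cost F) :
    (tabUpTo m f).cost = ∑ j ∈ Finset.range m, (f j).cost := rfl

theorem val_dotFrom {ι : Type} (x₀ : F) (l : List ι) (a y : ι → F) :
    (dotFrom x₀ l a y).val = x₀ + (l.map fun i => a i * y i).sum := by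
  unfold dotFrom
  induction l generalizing x₀ with
  | nil => simp
  | cons i l ih => simp [ih, add_assoc]

theorem val_dotFrom_finRange {m : ℕ} (x₀ : F) (a y : Fin m → F) :
    (dotFrom x₀ (List.finRange m) a y).val = x₀ + ∑ i, a i * y i := by
  rw [val_dotFrom, List.sum_ofFn.symm, List.ofFn_eq_map]

theorem val_vecMul {n : ℕ} (v : Fin n → F) (M : Matrix (Fin n) (Fin n) F) :
    (vecMul v M).val = Matrix.vecMul v M := by
  ext j
  simp [vecMul, val_dotFrom_finRange, Matrix.vecMul, dotProduct]

theorem val_vecMulLower {m : ℕ} (a : Fin m → F) (T : Matrix (Fin m) (Fin m) F)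
    (hT : ∀ i c, i < c → T i c = 0) : (vecMulLower a T).val = Matrix.vecMul a T := by
  ext c
  have hsum : ∀ l : List (Fin m), ((l.filter (fun i => c ≤ i)).map fun i => a i * T i c).sum
      = (l.map fun i => a i * T i c).sum := by
    intro l
    induction l with
    | nil => simp
    | cons i l ih =>
      by_cases hi : c ≤ i
      · simp [hi, ih]
      · simp [hi, ih, hT i c (not_le.1 hi)]
  simp only [vecMulLower, val_tab, val_dotFrom, hsum, zero_add]
  rw [← List.ofFn_eq_map, List.sum_ofFn]; rfl

/-! ### Semi echelon data sequences -/

/-- The invariants of a semi echelon data sequence: `T` is lower triangular with `T * Y = S`, and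
each row of `S` has a one in its leading column, below which `S` vanishes. -/
structure SemiEchelon.Valid {n : ℕ} (E : SemiEchelon F n) : Prop where
  one : ∀ i, E.S i (E.lc i) = 1
  zero : ∀ i j, i < j → E.S j (E.lc i) = 0
  lower : ∀ i c, i < c → E.T i c = 0
  mul : E.T * E.Y = E.S

/-- The rows of `Y`, numbered by natural numbers and followed by zeros. -/
def SemiEchelon.row {n : ℕ} (E : SemiEchelon F n) (j : ℕ) : Fin n → F :=
  if h : j < E.len then E.Y ⟨j, h⟩ else 0

theorem SemiEchelon.valid_trivial (n : ℕ) : (SemiEchelon.trivial F n).Valid where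
  one i := i.elim0
  zero i := i.elim0
  lower i := i.elim0
  mul := by ext i; exact i.elim0

namespace SemiEchelon.Valid

variable {n : ℕ} {E : SemiEchelon F n}

theorem lc_injective (hE : E.Valid) : Function.Injective E.lc := by
  have key : ∀ i j, i < j → E.lc i ≠ E.lc j := by
    intro i j hij h
    have := hE.zero i j hij
    rw [h, hE.one j] at this
    exact one_ne_zero this
  intro i j h
  rcases lt_trichotomy i j with hij | hij | hij
  · exact absurd h (key i j hij)
  · exact hij
  · exact absurd h.symm (key j i hij)

theorem len_le (hE : E.Valid) : E.len ≤ n := by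
  simpa using Fintype.card_le_of_injective _ hE.lc_injective

/-- A combination of the rows of `S` is determined by its entries in the leading columns. -/
theorem eq_zero_of_vecMul_lc (hE : E.Valid) (a : Fin E.len → F)
    (h : ∀ i, Matrix.vecMul a E.S (E.lc i) = 0) : a = 0 := by
  have H : ∀ m : ℕ, ∀ i : Fin E.len, (i : ℕ) = m → a i = 0 := by
    intro m
    induction m using Nat.strong_induction_on with
    | _ m ih =>
      intro i hi
      have h1 := h i
      simp only [Matrix.vecMul, dotProduct] at h1
      rw [Finset.sum_eq_single i] at h1
      · simpa [hE.one i] using h1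
      · intro j _ hji
        rcases lt_or_gt_of_ne hji with hlt | hlt
        · rw [ih j (by rw [← hi]; exact hlt) j rfl, zero_mul]
        · rw [hE.zero i j hlt, mul_zero]
      · simp
  ext i
  exact H i i rfl

theorem vecMul_T_Y (hE : E.Valid) (a : Fin E.len → F) :
    Matrix.vecMul (Matrix.vecMul a E.T) E.Y = Matrix.vecMul a E.S := by
  rw [Matrix.vecMul_vecMul, hE.mul]

/-- The rows of `Y` are independent: `a ↦ a T` is injective since the rows of `S = T Y` are
independent, hence it is surjective, and a relation `c Y = 0` with `c = a T` gives `a S = 0`. -/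
theorem eq_zero_of_vecMul_Y (hE : E.Valid) (c : Fin E.len → F)
    (h : Matrix.vecMul c E.Y = 0) : c = 0 := by
  have hinj : Function.Injective (Matrix.vecMulLinear E.T) := by
    rw [← LinearMap.ker_eq_bot, LinearMap.ker_eq_bot']
    intro a ha
    apply hE.eq_zero_of_vecMul_lc
    intro i
    rw [← hE.vecMul_T_Y]
    have : Matrix.vecMul a E.T = 0 := ha
    simp [this]
  obtain ⟨a, ha⟩ := LinearMap.injective_iff_surjective.1 hinj c
  have ha' : Matrix.vecMul a E.T = c := ha
  have : a = 0 := by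
    apply hE.eq_zero_of_vecMul_lc
    intro i
    rw [← hE.vecMul_T_Y, ha', h]; rfl
  rw [← ha', this, Matrix.zero_vecMul]

end SemiEchelon.Valid

/-- Appending a row `v = a S + w` to a semi echelon data sequence, where `w` vanishes in the leading
columns found so far and `x` is the inverse of its entry in the new leading column `j₀`. -/
theorem SemiEchelon.Valid.append {n : ℕ} {E : SemiEchelon F n} (hE : E.Valid)
    {v w : Fin n → F} {a : Fin E.len → F} {x : F} {j₀ : Fin n}
    (hv : v = Matrix.vecMul a E.S + w) (hw : ∀ i, w (E.lc i) = 0) (hx : x * w j₀ = 1)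
    {Y S : Matrix (Fin (E.len + 1)) (Fin n) F} {T : Matrix (Fin (E.len + 1)) (Fin (E.len + 1)) F}
    {lc : Fin (E.len + 1) → Fin n}
    (hY : ∀ i : Fin E.len, Y i.castSucc = E.Y i) (hY' : Y (Fin.last _) = v)
    (hS : ∀ i : Fin E.len, S i.castSucc = E.S i) (hS' : S (Fin.last _) = x • w)
    (hT : ∀ i c : Fin E.len, T i.castSucc c.castSucc = E.T i c)
    (hT₀ : ∀ i : Fin E.len, T i.castSucc (Fin.last _) = 0)
    (hT' : ∀ c : Fin E.len, T (Fin.last _) c.castSucc = -x * Matrix.vecMul a E.T c)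
    (hT₁ : T (Fin.last _) (Fin.last _) = x)
    (hlc : ∀ i : Fin E.len, lc i.castSucc = E.lc i) (hlc' : lc (Fin.last _) = j₀) :
    (⟨E.len + 1, Y, S, T, lc⟩ : SemiEchelon F n).Valid := by
  constructor
  · intro i
    refine Fin.lastCases ?_ (fun i => ?_) i
    · simp [hS', hlc', hx]
    · simp [hS, hlc, hE.one i]
  · intro i j
    refine Fin.lastCases ?_ (fun j => ?_) j
    · refine Fin.lastCases ?_ (fun i => ?_) i
      · simp
      · simp [hS', hlc, hw i]
    · refine Fin.lastCases ?_ (fun i => ?_) i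
      · intro h
        exact absurd h (not_lt.2 (Fin.le_last _))
      · intro h
        simpa [hS, hlc] using hE.zero i j (by simpa using h)
  · intro i c
    refine Fin.lastCases ?_ (fun i => ?_) i
    · intro h
      exact absurd h (not_lt.2 (Fin.le_last _))
    · refine Fin.lastCases ?_ (fun c => ?_) c
      · simp [hT₀]
      · intro h
        simpa [hT] using hE.lower i c (by simpa using h)
  · ext i j
    refine Fin.lastCases ?_ (fun i => ?_) i
    · have h3 : ∑ y, Matrix.vecMul a E.T y * E.Y y j = v j - w j := by
        have h4 := congrFun hv j
        rw [Pi.add_apply, ← congrFun (hE.vecMul_T_Y a) j] at h4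
        rw [h4]; simp [Matrix.vecMul, dotProduct]
      simp only [Matrix.mul_apply, Fin.sum_univ_castSucc, hT', hT₁, hY, hY', hS', Pi.smul_apply,
        smul_eq_mul, mul_assoc]
      rw [← Finset.mul_sum, h3]; ring
    · simp only [Matrix.mul_apply, Fin.sum_univ_castSucc, hT, hT₀, hY, hS, zero_mul, add_zero]
      rw [← hE.mul, Matrix.mul_apply]

/-- `clean` reduces `v` modulo the rows of `S`. When row `i` has been treated, the remainder
vanishes in the leading columns of rows `0, …, i`, since later rows of `S` vanish there. -/
theorem clean_spec {n : ℕ} {E : SemiEchelon F n} (hE : E.Valid) (v : Fin n → F) :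
    v = Matrix.vecMul (clean E v).val.1 E.S + (clean E v).val.2 ∧
      ∀ i, (clean E v).val.2 (E.lc i) = 0 := by
  have H := foldl_finRange_induction (m := E.len)
    (fun (aw : (Fin E.len → F) × (Fin n → F)) (i : Fin E.len) =>
      (Function.update aw.1 i (aw.2 (E.lc i)), fun j => aw.2 j - aw.2 (E.lc i) * E.S i j))
    (fun m aw => v = Matrix.vecMul aw.1 E.S + aw.2 ∧
      (∀ i : Fin E.len, (i : ℕ) < m → aw.2 (E.lc i) = 0) ∧ ∀ i : Fin E.len, m ≤ i → aw.1 i = 0)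
    ((fun _ => 0), v) ⟨by
      have : (fun _ => 0 : Fin E.len → F) = 0 := rfl
      simp [this], by simp, by simp⟩ ?_
  · obtain ⟨h1, h2, -⟩ := H
    have hval : (clean E v).val = (List.finRange E.len).foldl
        (fun (aw : (Fin E.len → F) × (Fin n → F)) (i : Fin E.len) =>
          (Function.update aw.1 i (aw.2 (E.lc i)), fun j => aw.2 j - aw.2 (E.lc i) * E.S i j))
        ((fun _ => 0), v) := by
      rw [clean, val_foldlM]; rfl
    rw [hval]
    exact ⟨h1, fun i => h2 i i.2⟩
  · rintro i ⟨a, w⟩ ⟨h1, h2, h3⟩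
    dsimp only at h1 h2 h3 ⊢
    refine ⟨?_, ?_, ?_⟩
    · have hup : Function.update a i (w (E.lc i)) = a + Pi.single i (w (E.lc i)) := by
        ext j
        by_cases hj : j = i
        · subst hj; simp [h3 j le_rfl]
        · simp [hj]
      rw [hup, Matrix.add_vecMul, Matrix.single_vecMul]
      conv_lhs => rw [h1]
      ext j
      simp [Matrix.row]
    · intro j hj
      rcases Nat.lt_succ_iff_lt_or_eq.1 hj with hlt | heq
      · rw [h2 j hlt, hE.zero j i hlt]; simp
      · have : j = i := Fin.ext heq
        subst this
        rw [hE.one]; simp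
    · intro j hj
      have hne : j ≠ i := by rintro rfl; omega
      rw [Function.update_of_ne hne]
      exact h3 j (by omega)

/-- Either `v` is a combination of the rows found so far, or it is appended to them. -/
theorem cleanAndExtend_spec [DecidableEq F] {n : ℕ} {E : SemiEchelon F n} (hE : E.Valid)
    (v : Fin n → F) :
    (∃ a, (cleanAndExtend E v).val = (true, ⟨E, a⟩) ∧ Matrix.vecMul a E.S = v) ∨
    (∃ E' a, (cleanAndExtend E v).val = (false, ⟨E', a⟩) ∧ E'.Valid ∧ E'.len = E.len + 1 ∧
      (∀ j < E.len, E'.row j = E.row j) ∧ E'.row E.len = v) := by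
  obtain ⟨h1, h2⟩ := clean_spec hE v
  simp only [cleanAndExtend, val_bind]
  generalize (clean E v).val = aw at h1 h2
  obtain ⟨a, w⟩ := aw
  dsimp only at h1 h2 ⊢
  cases hf : (List.finRange n).find? (fun j => w j ≠ 0) with
  | none =>
    left
    refine ⟨a, rfl, ?_⟩
    have hw : w = 0 := by
      ext j
      have := List.find?_eq_none.1 hf j (List.mem_finRange j)
      simpa using this
    rw [h1, hw, add_zero]
  | some j₀ =>
    right
    have hj₀ : w j₀ ≠ 0 := by simpa using List.find?_some hf
    refine ⟨_, _, rfl, ?_, rfl, ?_, ?_⟩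
    · have haT := val_vecMulLower a E.T hE.lower
      refine hE.append (x := 1 / w j₀) h1 h2 (by field_simp)
        (fun i => Fin.snoc_castSucc (α := fun _ => Fin n → F) v E.Y i)
        (Fin.snoc_last (α := fun _ => Fin n → F) v E.Y)
        (fun i => Fin.snoc_castSucc (α := fun _ => Fin n → F) _ E.S i)
        ((Fin.snoc_last (α := fun _ => Fin n → F) _ E.S).trans rfl)
        (fun i c => ?_) (fun i => ?_) (fun c => ?_) ?_
        (fun i => Fin.snoc_castSucc (α := fun _ => Fin n) j₀ E.lc i)
        (Fin.snoc_last (α := fun _ => Fin n) j₀ E.lc)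
      · rw [Fin.snoc_castSucc]; exact Fin.snoc_castSucc (α := fun _ => F) _ _ _
      · rw [Fin.snoc_castSucc]; exact Fin.snoc_last (α := fun _ => F) _ _
      · rw [Fin.snoc_last]
        refine (Fin.snoc_castSucc (α := fun _ => F) _ _ _).trans ?_
        simp [haT]
      · rw [Fin.snoc_last]; exact Fin.snoc_last (α := fun _ => F) _ _
    · intro j hj
      have hj' : j < E.len + 1 := by omega
      simp only [SemiEchelon.row, hj, hj', dite_true]
      exact Fin.snoc_castSucc (α := fun _ => Fin n → F) v E.Y ⟨j, hj⟩
    · simp only [SemiEchelon.row, Nat.lt_succ_self, dite_true]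
      exact Fin.snoc_last (α := fun _ => Fin n → F) v E.Y

/-! ### The chain of cyclic subspaces found by `charPoly` -/

theorem blockEnd_zero (bs : List (Block F)) : blockEnd bs 0 = 0 := rfl

theorem blockEnd_succ {bs : List (Block F)} {i : ℕ} (h : i < bs.length) :
    blockEnd bs (i + 1) = blockEnd bs i + bs[i].p.natDegree := by
  unfold blockEnd
  rw [List.take_add_one]
  simp [h]

theorem blockEnd_le_succ (bs : List (Block F)) (i : ℕ) : blockEnd bs i ≤ blockEnd bs (i + 1) := by
  rcases lt_or_ge i bs.length with h | h
  · rw [blockEnd_succ h]; exact Nat.le_add_right _ _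
  · simp [blockEnd, List.take_of_length_le h, List.take_of_length_le (Nat.le_succ_of_le h)]

theorem blockEnd_mono (bs : List (Block F)) : Monotone (blockEnd bs) :=
  monotone_nat_of_le_succ (blockEnd_le_succ bs)

theorem blockEnd_append {bs : List (Block F)} (cs : List (Block F)) {i : ℕ} (h : i ≤ bs.length) :
    blockEnd (bs ++ cs) i = blockEnd bs i := by
  simp [blockEnd, List.take_append_of_le_length h]

theorem ne_blockEnd_iff {bs : List (Block F)} {i t : ℕ} (hi : i < bs.length)
    (ht : t < bs[i].p.natDegree) : (∀ l, blockEnd bs i + t ≠ blockEnd bs l) ↔ t ≠ 0 := by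
  constructor
  · rintro h rfl
    exact h i rfl
  · intro h0 l hl
    rcases Nat.lt_or_ge i l with h | h
    · have := blockEnd_mono bs h
      rw [Nat.succ_eq_add_one, blockEnd_succ hi] at this
      omega
    · have := blockEnd_mono bs h
      omega

/-- The block `B` describes the rows from number `s` on: they are the images of `Y s` under the
powers of `M` until `M ^ d` maps `Y s` to a combination of the rows found by then, whose
coefficients on the rows of this block make up the polynomial of `B`. -/
structure IsBlock {n : ℕ} (M : Matrix (Fin n) (Fin n) F) (B : Block F) (s : ℕ)
    (Y : ℕ → Fin n → F) : Prop where
  pos : 0 < B.p.natDegree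
  shift : ∀ t < B.p.natDegree, Y (s + t) = Matrix.vecMul (Y s) (M ^ t)
  last : Matrix.vecMul (Y s) (M ^ B.p.natDegree) =
    ∑ j ∈ Finset.range (s + B.p.natDegree), B.b j • Y j
  poly : B.p = X ^ B.p.natDegree - ∑ t ∈ Finset.range B.p.natDegree, C (B.b (s + t)) * X ^ t

theorem IsBlock.congr {n : ℕ} {M : Matrix (Fin n) (Fin n) F} {B : Block F} {s : ℕ}
    {Y Y' : ℕ → Fin n → F} (h : IsBlock M B s Y)
    (hY : ∀ j < s + B.p.natDegree, Y' j = Y j) : IsBlock M B s Y' where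
  pos := h.pos
  shift t ht := by
    rw [hY _ (by omega), h.shift t ht, hY s (by have := h.pos; omega)]
  last := by
    rw [hY s (by have := h.pos; omega), h.last]
    refine Finset.sum_congr rfl fun j hj => ?_
    rw [hY j (Finset.mem_range.1 hj)]
  poly := h.poly

/-- The blocks of `bs` describe consecutive rows of `Y`. -/
def Chain {n : ℕ} (M : Matrix (Fin n) (Fin n) F) (bs : List (Block F)) (Y : ℕ → Fin n → F) :
    Prop :=
  ∀ i (h : i < bs.length), IsBlock M bs[i] (blockEnd bs i) Y

/-- Spinning up `v`. The bound on the number of rounds is never reached, because at most `n` rows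
are independent; so the last image of `v` is always a combination of the rows. -/
theorem relativeOrdPolyLoop_spec [DecidableEq F] {n : ℕ} (M : Matrix (Fin n) (Fin n) F) (r : ℕ) :
    ∀ (E : SemiEchelon F n) (v : Fin n → F), E.Valid → n + 1 ≤ r + E.len →
      ∃ E' a, (relativeOrdPolyLoop M r E v).val = ⟨E', a⟩ ∧ E'.Valid ∧ E.len ≤ E'.len ∧
        (∀ j < E.len, E'.row j = E.row j) ∧
        (∀ t, E.len + t < E'.len → E'.row (E.len + t) = Matrix.vecMul v (M ^ t)) ∧
        Matrix.vecMul a E'.S = Matrix.vecMul v (M ^ (E'.len - E.len)) ∧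
        (E'.len = E.len → ∃ a, Matrix.vecMul a E.S = v) := by
  induction r with
  | zero =>
    intro E v hE hr
    have := hE.len_le
    omega
  | succ r ih =>
    intro E v hE hr
    rcases cleanAndExtend_spec hE v with ⟨a, h1, h2⟩ | ⟨E₁, a, h1, hE₁, hlen, hrow, hlast⟩
    · refine ⟨E, a, ?_, hE, le_rfl, fun _ _ => rfl, fun t ht => by omega, by simp [h2],
        fun _ => ⟨a, h2⟩⟩
      simp [relativeOrdPolyLoop, h1]
    · obtain ⟨E', b, k1, k2, k3, k4, k5, k6, -⟩ :=
        ih E₁ (Matrix.vecMul v M) hE₁ (by omega)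
      refine ⟨E', b, ?_, k2, by omega, fun j hj => ?_, fun t ht => ?_, ?_, fun h => by omega⟩
      · simp [relativeOrdPolyLoop, h1, val_vecMul, k1]
      · rw [k4 j (by omega), hrow j hj]
      · rcases t with _ | t
        · rw [add_zero, k4 _ (by omega), hlast]; simp
        · have := k5 t (by omega)
          rw [hlen] at this
          rw [show E.len + (t + 1) = E.len + 1 + t by omega, this, Matrix.vecMul_vecMul, pow_succ']
      · rw [k6, Matrix.vecMul_vecMul, ← pow_succ', hlen]
        congr 2
        omega

theorem natDegree_X_pow_add_sum (d : ℕ) (c : ℕ → F) :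
    (X ^ d + ∑ i ∈ Finset.range d, C (c i) * X ^ i : F[X]).natDegree = d := by
  apply natDegree_eq_of_degree_eq_some
  have h : (∑ i ∈ Finset.range d, C (c i) * X ^ i : F[X]).degree < (X ^ d : F[X]).degree := by
    rw [degree_X_pow]
    exact (degree_sum_le _ _).trans_lt ((Finset.sup_lt_iff (WithBot.bot_lt_coe d)).2
      fun i hi => (degree_C_mul_X_pow_le _ _).trans_lt
        (WithBot.coe_lt_coe.2 (Finset.mem_range.1 hi)))
  rw [degree_add_eq_left_of_degree_lt h, degree_X_pow]

theorem relativeOrdPoly_spec [DecidableEq F] {n : ℕ} {E : SemiEchelon F n} (hE : E.Valid)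
    {v : Fin n → F} (M : Matrix (Fin n) (Fin n) F) (hv : ∀ a, Matrix.vecMul a E.S ≠ v) :
    ∃ B E', (relativeOrdPoly E v M).val = (B, E') ∧ E'.Valid ∧
      E'.len = E.len + B.p.natDegree ∧ (∀ j < E.len, E'.row j = E.row j) ∧
      IsBlock M B E.len E'.row := by
  obtain ⟨E', a, h1, hE', hle, hrow, hshift, hlast, hne⟩ :=
    relativeOrdPolyLoop_spec M (n + 1) E v hE (by omega)
  have hlt : E.len < E'.len := by
    refine lt_of_le_of_ne hle fun h => ?_
    obtain ⟨a, ha⟩ := hne h.symm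
    exact hv a ha
  refine ⟨⟨X ^ (E'.len - E.len) + ∑ i ∈ Finset.range (E'.len - E.len),
      C (-(if h : E.len + i < E'.len then Matrix.vecMul a E'.T ⟨E.len + i, h⟩ else 0)) * X ^ i,
      fun j => if h : j < E'.len then Matrix.vecMul a E'.T ⟨j, h⟩ else 0⟩,
    E', ?_, hE', ?_, hrow, ?_⟩
  · simp only [relativeOrdPoly, val_bind]
    generalize (relativeOrdPolyLoop M (n + 1) E v).val = x at h1
    subst h1
    simp only [val_vecMulLower a E'.T hE'.lower, val_pure, Prod.mk.injEq, and_true,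
      Block.mk.injEq]
    congr 1
    refine Finset.sum_congr rfl fun i hi => ?_
    simp [Finset.mem_range.1 hi]
  · simp only [natDegree_X_pow_add_sum]
    omega
  · have hd := natDegree_X_pow_add_sum (E'.len - E.len) fun i =>
      -(if h : E.len + i < E'.len then Matrix.vecMul a E'.T ⟨E.len + i, h⟩ else 0)
    have h0 : E'.row E.len = v := by simpa using hshift 0 (by omega)
    constructor
    · simp only [hd]; omega
    · simp only [hd]
      intro t ht
      rw [h0, hshift t (by omega)]
    · simp only [hd]
      rw [h0, ← hlast, ← hE'.vecMul_T_Y, Nat.add_sub_cancel' hle, Finset.sum_range,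
        Matrix.vecMul_eq_sum]
      refine Finset.sum_congr rfl fun i _ => ?_
      simp [SemiEchelon.row]
    · simp only [hd]
      rw [sub_eq_add_neg, ← Finset.sum_neg_distrib]
      simp only [C_neg, neg_mul]

theorem Chain.append {n : ℕ} {M : Matrix (Fin n) (Fin n) F} {bs : List (Block F)}
    {Y Y' : ℕ → Fin n → F} {B : Block F} (h : Chain M bs Y)
    (hY : ∀ j < blockEnd bs bs.length, Y' j = Y j)
    (hB : IsBlock M B (blockEnd bs bs.length) Y') : Chain M (bs ++ [B]) Y' := by
  intro i hi
  rw [List.length_append, List.length_singleton] at hi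
  rcases Nat.lt_succ_iff_lt_or_eq.1 hi with hlt | rfl
  · rw [List.getElem_append_left hlt, blockEnd_append _ hlt.le]
    refine (h i hlt).congr fun j hj => hY j (hj.trans_le ?_)
    rw [← blockEnd_succ hlt]
    exact blockEnd_mono bs hlt
  · simpa [blockEnd_append _ le_rfl] using hB

theorem charPolyLoop_spec [DecidableEq F] {n : ℕ} (ξ : ℕ → ℕ) (ω : RandomOutcome F n)
    (M : Matrix (Fin n) (Fin n) F) (r : ℕ) :
    ∀ (i : ℕ) (E : SemiEchelon F n) (bs : List (Block F)), E.Valid → n ≤ r + E.len →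
      E.len = blockEnd bs bs.length → Chain M bs E.row →
      ∃ bs' E', (charPolyLoop ξ ω M r i E bs).val = (bs', E') ∧ E'.Valid ∧ E'.len = n ∧
        blockEnd bs' bs'.length = n ∧ Chain M bs' E'.row := by
  induction r with
  | zero =>
    intro i E bs hE hr hlen hch
    have : E.len = n := le_antisymm hE.len_le (by omega)
    exact ⟨bs, E, rfl, hE, this, by omega, hch⟩
  | succ r ih =>
    intro i E bs hE hr hlen hch
    by_cases hlt : E.len < n
    · obtain ⟨v, hv⟩ : ∃ v, v = fun j => ω.vecStar i E.len E.lc j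
          + ∑ r, ω.vec i E.len r * E.S r j := ⟨_, rfl⟩
      -- The part of `v` outside the row space vanishes in the leading columns, so it cannot be
      -- a combination of the rows unless it is zero.
      have hnot : ∀ a, Matrix.vecMul a E.S ≠ v := by
        intro a ha
        have hstar : ω.vecStar i E.len E.lc = Matrix.vecMul (a - ω.vec i E.len) E.S := by
          rw [Matrix.sub_vecMul, ha, hv]
          ext j
          simp [Matrix.vecMul, dotProduct]
        refine ω.vecStar_ne_zero i E.len E.lc ?_ ?_
        · by_contra hcon
          push Not at hcon
          have := Fintype.card_le_of_surjective E.lc hcon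
          simp at this
          omega
        · have hzero : a - ω.vec i E.len = 0 := hE.eq_zero_of_vecMul_lc _ fun r => by
            rw [← hstar]
            exact ω.vecStar_mem i E.len E.lc r
          rw [hstar, hzero, Matrix.zero_vecMul]
      obtain ⟨B, E₁, h1, hE₁, hlen₁, hrow, hB⟩ := relativeOrdPoly_spec hE M hnot
      have hpos := hB.pos
      obtain ⟨bs', E', k1, k2⟩ := ih (i + 1) E₁ (bs ++ [B]) hE₁ (by omega)
        (by
          rw [List.length_append, List.length_singleton, blockEnd_succ (by simp),
            blockEnd_append _ le_rfl, hlen₁, hlen]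
          simp)
        (hch.append (fun j hj => hrow j (by omega)) (hlen ▸ hB))
      refine ⟨bs', E', ?_, k2⟩
      have hval : (tab fun j => dotFrom (ω.vecStar i E.len E.lc j) (List.finRange E.len)
          (ω.vec i E.len) (fun r => E.S r j)).val = v := by
        ext j
        simp [val_dotFrom_finRange, hv]
      simp only [charPolyLoop, hlt, if_true, val_bind, hval, h1, k1]
    · have : E.len = n := le_antisymm hE.len_le (by omega)
      refine ⟨bs, E, by simp [charPolyLoop, hlt], hE, this, by omega, hch⟩

/-- The rows `Y 0, …, Y (n - 1)` form a basis of `F ^ n`, which the blocks of `bs` divide into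
cyclic chains. -/
structure CyclicBasis {n : ℕ} (M : Matrix (Fin n) (Fin n) F) (bs : List (Block F))
    (Y : ℕ → Fin n → F) : Prop where
  chain : Chain M bs Y
  blockEnd_eq : blockEnd bs bs.length = n
  indep : ∀ c : ℕ → F, ∑ j ∈ Finset.range n, c j • Y j = 0 → ∀ j < n, c j = 0

theorem charPoly_spec [DecidableEq F] {n : ℕ} (ξ : ℕ → ℕ) (ω : RandomOutcome F n)
    (M : Matrix (Fin n) (Fin n) F) :
    ∃ Y : ℕ → Fin n → F, CyclicBasis M (charPoly ξ ω M).val.1 Y := by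
  obtain ⟨bs, E, h1, h2, h3, h4, h5⟩ := charPolyLoop_spec ξ ω M n 1 (SemiEchelon.trivial F n) []
    (SemiEchelon.valid_trivial n) (by omega) rfl (fun i hi => by simp at hi)
  refine ⟨E.row, ?_, ?_, ?_⟩
  · rw [charPoly, h1]; exact h5
  · rw [charPoly, h1]; exact h4
  · intro c hc j hj
    have hc' : ∑ j ∈ Finset.range E.len, c j • E.row j = 0 := by rwa [h3]
    have := h2.eq_zero_of_vecMul_Y (fun i => c i) (by
      rw [Matrix.vecMul_eq_sum, ← hc', Finset.sum_range]
      refine Finset.sum_congr rfl fun i _ => ?_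
      simp [SemiEchelon.row])
    exact congrFun this ⟨j, by omega⟩

/-! ### Factorised polynomials and trial division -/

/-- All bases occurring in a factorised polynomial are monic irreducible. -/
def Factorised.IsIrred (f : Factorised F) : Prop := ∀ q ∈ f.support, q.Monic ∧ Irreducible q

namespace Factorised

theorem isIrred_zero : (0 : Factorised F).IsIrred := by simp [IsIrred]

theorem IsIrred.add {f g : Factorised F} (hf : f.IsIrred) (hg : g.IsIrred) :
    (f + g).IsIrred := by
  intro q hq
  by_contra hcon
  have h1 : f q = 0 := by simpa using mt (hf q) hcon
  have h2 : g q = 0 := by simpa using mt (hg q) hcon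
  simp [h1, h2] at hq

theorem IsIrred.lcm {f g : Factorised F} (hf : f.IsIrred) (hg : g.IsIrred) :
    (f.lcm g).IsIrred := by
  intro q hq
  by_contra hcon
  have h1 : f q = 0 := by simpa using mt (hf q) hcon
  have h2 : g q = 0 := by simpa using mt (hg q) hcon
  simp [Factorised.lcm, h1, h2] at hq

theorem IsIrred.mono {f g : Factorised F} (hg : g.IsIrred) (h : f ≤ g) : f.IsIrred := by
  intro q hq
  refine hg q ?_
  have := h q
  rw [Finsupp.mem_support_iff] at hq ⊢
  omega

theorem IsIrred.value_monic {f : Factorised F} (hf : f.IsIrred) : f.value.Monic :=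
  monic_prod_of_monic _ _ fun q hq => (hf q hq).1.pow _

theorem value_add (f g : Factorised F) : (f + g).value = f.value * g.value :=
  Finsupp.prod_add_index' (fun _ => pow_zero _) fun _ _ _ => pow_add _ _ _

theorem value_zero : (0 : Factorised F).value = 1 := Finsupp.prod_zero_index

theorem deg_add (f g : Factorised F) : (f + g).deg = f.deg + g.deg :=
  Finsupp.sum_add_index' (fun _ => zero_mul _) fun _ _ _ => add_mul _ _ _

theorem IsIrred.natDegree_value {f : Factorised F} (hf : f.IsIrred) :
    f.value.natDegree = f.deg := by
  rw [value, deg, Finsupp.prod, Finsupp.sum, natDegree_prod_of_monic]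
  · exact Finset.sum_congr rfl fun q _ => natDegree_pow _ _
  · exact fun q hq => (hf q hq).1.pow _

theorem deg_mono {f g : Factorised F} (h : f ≤ g) : f.deg ≤ g.deg := by
  rw [← tsub_add_cancel_of_le h, deg_add]
  exact Nat.le_add_left _ _

/-- Powers of distinct monic irreducible polynomials are coprime, so divisibility can be tested
one irreducible factor at a time. -/
theorem IsIrred.value_dvd_iff {f : Factorised F} (hf : f.IsIrred) (u : F[X]) :
    f.value ∣ u ↔ ∀ q, q ^ f q ∣ u := by
  constructor
  · intro h q
    by_cases hq : q ∈ f.support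
    · exact (Finset.dvd_prod_of_mem (fun q => q ^ f q) hq).trans h
    · simp [Finsupp.notMem_support_iff.1 hq]
  · intro h
    refine Finset.prod_dvd_of_coprime (fun q hq q' hq' hne => ?_) fun q _ => h q
    refine IsCoprime.pow ?_
    rw [(hf q hq).2.coprime_iff_not_dvd]
    intro hdvd
    exact hne (eq_of_monic_of_associated (hf q hq).1 (hf q' hq').1
      ((hf q hq).2.associated_of_dvd (hf q' hq').2 hdvd))

theorem IsIrred.value_lcm_dvd_iff {f g : Factorised F} (hf : f.IsIrred) (hg : g.IsIrred)
    (u : F[X]) : (f.lcm g).value ∣ u ↔ f.value ∣ u ∧ g.value ∣ u := by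
  rw [(hf.lcm hg).value_dvd_iff, hf.value_dvd_iff, hg.value_dvd_iff, ← forall_and]
  refine forall_congr' fun q => ?_
  have : (f.lcm g) q = max (f q) (g q) := rfl
  rw [this]
  constructor
  · exact fun h => ⟨(pow_dvd_pow q (le_max_left _ _)).trans h,
      (pow_dvd_pow q (le_max_right _ _)).trans h⟩
  · rintro ⟨h1, h2⟩
    rcases max_choice (f q) (g q) with h | h <;> rwa [h]

end Factorised

/-- The polynomial with coefficients `h 0, …, h (L - 1)`. -/
def polyOf (L : ℕ) (h : ℕ → F) : F[X] := ∑ j ∈ Finset.range L, C (h j) * X ^ j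

theorem coeff_polyOf (L : ℕ) (h : ℕ → F) (m : ℕ) :
    (polyOf L h).coeff m = if m < L then h m else 0 := by
  simp [polyOf, coeff_C_mul, coeff_X_pow]

theorem divInPlace_eq_of_le {q : F[X]} (r : ℕ) (h : ℕ → F) {j : ℕ} (hj : r + q.natDegree ≤ j) :
    (divInPlace q r h).val j = h j := by
  induction r generalizing h with
  | zero => rfl
  | succ r ih =>
    simp only [divInPlace, val_bind]
    rw [ih _ (by omega), if_neg (by omega)]

/-- Division in place is division with remainder. -/
theorem divInPlace_spec {q : F[X]} (hq : q.Monic) (r : ℕ) (h : ℕ → F) :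
    polyOf (r + q.natDegree) h =
      polyOf r (fun j => (divInPlace q r h).val (j + q.natDegree)) * q +
        polyOf q.natDegree (divInPlace q r h).val := by
  induction r generalizing h with
  | zero => simp [divInPlace, polyOf]
  | succ r ih =>
    simp only [divInPlace, val_bind]
    set h₁ : ℕ → F := fun j => if r ≤ j ∧ j < r + q.natDegree then
      (tabUpTo q.natDegree fun j => subMul (h (r + j)) (h (r + q.natDegree)) (q.coeff j)).val
        (j - r) else h j with hh₁
    have hlast : (divInPlace q r h₁).val (r + q.natDegree) = h (r + q.natDegree) := by
      rw [divInPlace_eq_of_le r h₁ le_rfl, hh₁]; simp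
    have hstep : polyOf (r + 1 + q.natDegree) h =
        C (h (r + q.natDegree)) * X ^ r * q + polyOf (r + q.natDegree) h₁ := by
      ext m
      rw [coeff_add, coeff_polyOf, coeff_polyOf, mul_assoc, coeff_C_mul, coeff_X_pow_mul']
      rcases lt_trichotomy m (r + q.natDegree) with hm | hm | hm
      · rw [if_pos (by omega), if_pos hm, hh₁]
        by_cases hr : r ≤ m
        · simp only [hr, hm, and_self, if_true, val_tabUpTo, val_subMul]
          rw [if_pos (by omega), Nat.add_sub_cancel' hr]
          ring
        · simp [hr]
      · subst hm
        rw [if_pos (by omega), if_pos (by omega), if_neg (by omega), Nat.add_sub_cancel_left,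
          hq.coeff_natDegree]
        ring
      · rw [if_neg (by omega), if_pos (by omega), if_neg (by omega),
          coeff_eq_zero_of_natDegree_lt (by omega)]
        ring
    rw [hstep, ih h₁, polyOf, polyOf, polyOf, Finset.sum_range_succ, hlast]
    ring

theorem cost_divInPlace (q : F[X]) (r : ℕ) (h : ℕ → F) :
    (divInPlace q r h).cost = r * (2 * q.natDegree) := by
  induction r generalizing h with
  | zero => simp [divInPlace]
  | succ r ih =>
    simp only [divInPlace, cost_bind, cost_tabUpTo, cost_subMul, Finset.sum_const,
      Finset.card_range, smul_eq_mul, ih]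
    ring

/-- The number `t` of successful trial divisions is the exponent of `q` in `gcd(h, q ^ e)`: either
`t = e`, or `q` does not divide the cofactor of `q ^ t`. This includes the case `h = 0`. -/
theorem gcdExponent_spec [DecidableEq F] {q : F[X]} (hq : q.Monic) (e : ℕ) :
    ∀ (L : ℕ) (h : ℕ → F), (∀ j, L ≤ j → h j = 0) →
      (gcdExponent q e L h).val.1 ≤ e ∧
      ∃ H, polyOf L h = q ^ (gcdExponent q e L h).val.1 * H ∧
        ((gcdExponent q e L h).val.1 = e ∨ ¬ q ∣ H) := by
  induction e with
  | zero => intro L h _; exact ⟨le_rfl, polyOf L h, by simp [gcdExponent], Or.inl rfl⟩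
  | succ e ih =>
    intro L h hL
    obtain ⟨r, hr⟩ : ∃ r, r = (divInPlace q (L - q.natDegree) h).val := ⟨_, rfl⟩
    have hdiv : polyOf L h = polyOf (L - q.natDegree) (fun j => r (j + q.natDegree)) * q +
        polyOf q.natDegree r := by
      rw [hr, ← divInPlace_spec hq]
      ext m
      rw [coeff_polyOf, coeff_polyOf]
      by_cases hm : m < L
      · rw [if_pos hm, if_pos (by omega)]
      · rw [if_neg hm, hL m (not_lt.1 hm), ite_self]
    simp only [gcdExponent, val_bind, ← hr]
    by_cases hrem : ∀ j < q.natDegree, r j = 0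
    · simp only [if_pos hrem, val_bind, val_pure]
      have hrem0 : polyOf q.natDegree r = 0 := by
        ext m
        rw [coeff_polyOf, coeff_zero]
        split_ifs with hm
        · exact hrem m hm
        · rfl
      obtain ⟨h1, H, h2, h3⟩ := ih (L - q.natDegree) (fun j => r (j + q.natDegree))
        (fun j hj => by
          rw [hr, divInPlace_eq_of_le _ _ (by omega)]
          exact hL _ (by omega))
      refine ⟨by omega, H, ?_, by simpa using h3⟩
      rw [hdiv, hrem0, add_zero, h2]
      ring
    · simp only [if_neg hrem, val_pure]
      refine ⟨Nat.zero_le _, polyOf L h, by simp, Or.inr fun hdvd => hrem ?_⟩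
      rw [hdiv, dvd_add_right (dvd_mul_left _ _)] at hdvd
      have hzero : polyOf q.natDegree r = 0 := by
        refine eq_zero_of_dvd_of_degree_lt hdvd ?_
        rw [degree_eq_natDegree hq.ne_zero, degree_lt_iff_coeff_zero]
        intro m hm
        rw [coeff_polyOf, if_neg (not_lt.2 hm)]
      intro j hj
      have := congrArg (fun p => p.coeff j) hzero
      simpa [coeff_polyOf, hj] using this

theorem cost_gcdExponent_le [DecidableEq F] (q : F[X]) (e : ℕ) :
    ∀ (L : ℕ) (h : ℕ → F), (gcdExponent q e L h).cost ≤ e * q.natDegree * (2 * L) := by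
  induction e with
  | zero => intro L h; simp [gcdExponent]
  | succ e ih =>
    intro L h
    have hL : L - q.natDegree ≤ L := Nat.sub_le _ _
    simp only [gcdExponent, cost_bind, cost_divInPlace]
    have h1 : (L - q.natDegree) * (2 * q.natDegree) ≤ q.natDegree * (2 * L) := by
      calc _ ≤ L * (2 * q.natDegree) := by gcongr
        _ = _ := by ring
    split_ifs with hrem
    · simp only [cost_bind, cost_pure, add_zero]
      have h2 := ih (L - q.natDegree)
        (fun j => (divInPlace q (L - q.natDegree) h).val (j + q.natDegree))
      have h3 : e * q.natDegree * (2 * (L - q.natDegree)) ≤ e * q.natDegree * (2 * L) := by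
        gcongr
      calc _ ≤ q.natDegree * (2 * L) + e * q.natDegree * (2 * L) := by omega
        _ = _ := by ring
    · simp only [cost_pure, add_zero]
      calc _ ≤ 1 * q.natDegree * (2 * L) := by simpa using h1
        _ ≤ _ := by gcongr; omega

theorem divGcd_val_apply [DecidableEq F] (p : Factorised F) (L : ℕ) (h : ℕ → F) (q : F[X]) :
    (divGcd p L h).val q = p q - (gcdExponent q (p q) L h).val.1 := by
  have H : ∀ (l : List F[X]) (g : Factorised F), l.Nodup →
      (l.foldl (fun (g : Factorised F) q =>
        g + Finsupp.single q (p q - (gcdExponent q (p q) L h).val.1)) g) q =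
      g q + if q ∈ l then p q - (gcdExponent q (p q) L h).val.1 else 0 := by
    intro l
    induction l with
    | nil => simp
    | cons q' l ih =>
      intro g hl
      rw [List.nodup_cons] at hl
      rw [List.foldl_cons, ih _ hl.2, Finsupp.add_apply]
      by_cases hq : q = q'
      · subst hq
        simp [hl.1]
      · simp [hq]
  rw [divGcd, val_foldlM]
  simp only [val_bind, val_pure]
  rw [H _ _ p.support.nodup_toList, Finsupp.coe_zero, Pi.zero_apply, zero_add]
  by_cases hq : q ∈ p.support
  · rw [if_pos (Finset.mem_toList.2 hq)]
  · rw [if_neg (mt Finset.mem_toList.1 hq), Finsupp.notMem_support_iff.1 hq, zero_tsub]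

theorem divGcd_le [DecidableEq F] (p : Factorised F) (L : ℕ) (h : ℕ → F) :
    (divGcd p L h).val ≤ p := by
  intro q
  rw [divGcd_val_apply]
  exact Nat.sub_le _ _

/-- The characteristic property of `p / gcd(h, p)`. -/
theorem value_divGcd_dvd_iff [DecidableEq F] {p : Factorised F} (hp : p.IsIrred) {L : ℕ}
    {h : ℕ → F} (hL : ∀ j, L ≤ j → h j = 0) (u : F[X]) :
    (divGcd p L h).val.value ∣ u ↔ p.value ∣ u * polyOf L h := by
  rw [(hp.mono (divGcd_le p L h)).value_dvd_iff, hp.value_dvd_iff]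
  refine forall_congr' fun q => ?_
  rw [divGcd_val_apply]
  by_cases hq : q ∈ p.support
  · obtain ⟨hmon, hirr⟩ := hp q hq
    obtain ⟨h1, H, h2, h3⟩ := gcdExponent_spec hmon (p q) L h hL
    set t := (gcdExponent q (p q) L h).val.1
    have hpow : q ^ p q = q ^ t * q ^ (p q - t) := by rw [← pow_add, Nat.add_sub_cancel' h1]
    rw [h2, hpow, show u * (q ^ t * H) = q ^ t * (u * H) by ring,
      mul_dvd_mul_iff_left (pow_ne_zero _ hmon.ne_zero)]
    rcases h3 with h3 | h3
    · simp [h3]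
    · have hcop : IsCoprime (q ^ (p q - t)) H := (hirr.coprime_iff_not_dvd.2 h3).pow_left
      exact ⟨fun h => dvd_mul_of_dvd_left h _, hcop.dvd_of_dvd_mul_right⟩
  · simp [Finsupp.notMem_support_iff.1 hq]

/-- Each of the trial divisions by `q` costs at most `2 L deg q`, and their number is at most the
multiplicity of `q`. -/
theorem cost_divGcd_le [DecidableEq F] (p : Factorised F) (L : ℕ) (h : ℕ → F) :
    (divGcd p L h).cost ≤ p.deg * (2 * L) := by
  refine (cost_foldlM_le _ (fun q => p q * q.natDegree * (2 * L)) _ ?_ _).trans (le_of_eq ?_)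
  · intro q _ g
    simpa using cost_gcdExponent_le q (p q) L h
  · rw [Finset.sum_map_toList, Factorised.deg, Finsupp.sum, Finset.sum_mul]

/-! ### The action of `M` in coordinates -/

/-- The combination of `Y 0, …, Y (m - 1)` with the given coefficients. -/
def comb {n : ℕ} (Y : ℕ → Fin n → F) (m : ℕ) : (ℕ → F) →ₗ[F] (Fin n → F) :=
  ∑ j ∈ Finset.range m, (LinearMap.proj j).smulRight (Y j)

section comb

variable {n : ℕ} (Y : ℕ → Fin n → F)

theorem comb_apply (m : ℕ) (w : ℕ → F) :
    comb Y m w = ∑ j ∈ Finset.range m, w j • Y j := by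
  simp [comb, LinearMap.sum_apply]

theorem comb_congr {m : ℕ} {w w' : ℕ → F} (h : ∀ j < m, w j = w' j) :
    comb Y m w = comb Y m w' := by
  rw [comb_apply, comb_apply]
  exact Finset.sum_congr rfl fun j hj => by rw [h j (Finset.mem_range.1 hj)]

theorem comb_indicator {m m' : ℕ} (h : m ≤ m') (w : ℕ → F) :
    comb Y m' (fun j => if j < m then w j else 0) = comb Y m w := by
  obtain ⟨e, rfl⟩ := Nat.exists_eq_add_of_le h
  rw [comb_apply, comb_apply, Finset.sum_range_add]
  simp only [Nat.not_lt.2 (Nat.le_add_right m _), if_false, zero_smul, Finset.sum_const_zero,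
    add_zero]
  exact Finset.sum_congr rfl fun j hj => by rw [if_pos (Finset.mem_range.1 hj)]

theorem comb_add_range (s d : ℕ) (w : ℕ → F) :
    comb Y (s + d) w = comb Y s w + ∑ t ∈ Finset.range d, w (s + t) • Y (s + t) := by
  rw [comb_apply, comb_apply, Finset.sum_range_add]

end comb

theorem IsBlock.vecMul_aeval_polyOf {n : ℕ} {M : Matrix (Fin n) (Fin n) F} {B : Block F} {s : ℕ}
    {Y : ℕ → Fin n → F} (h : IsBlock M B s Y) (c : ℕ → F) :
    Matrix.vecMul (Y s) (aeval M (polyOf B.p.natDegree c)) =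
      ∑ t ∈ Finset.range B.p.natDegree, c t • Y (s + t) := by
  rw [polyOf, map_sum, Matrix.vecMul_sum]
  refine Finset.sum_congr rfl fun t ht => ?_
  rw [h.shift t (Finset.mem_range.1 ht), ← smul_eq_C_mul, map_smul, map_pow, aeval_X,
    Matrix.vecMul_smul]

/-- The polynomial of a block maps its first vector into the span of the earlier rows. -/
theorem IsBlock.vecMul_aeval_p {n : ℕ} {M : Matrix (Fin n) (Fin n) F} {B : Block F} {s : ℕ}
    {Y : ℕ → Fin n → F} (h : IsBlock M B s Y) :
    Matrix.vecMul (Y s) (aeval M B.p) = comb Y s B.b := by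
  have hp : B.p = X ^ B.p.natDegree - polyOf B.p.natDegree (fun t => B.b (s + t)) := h.poly
  rw [congrArg (aeval M) hp, map_sub, Matrix.vecMul_sub, map_pow, aeval_X, h.last,
    h.vecMul_aeval_polyOf, Finset.sum_range_add, comb_apply, add_sub_cancel_right]

theorem IsBlock.monic {n : ℕ} {M : Matrix (Fin n) (Fin n) F} {B : Block F} {s : ℕ}
    {Y : ℕ → Fin n → F} (h : IsBlock M B s Y) : B.p.Monic := by
  rw [Monic, leadingCoeff]
  have hp : B.p = X ^ B.p.natDegree - polyOf B.p.natDegree (fun t => B.b (s + t)) := h.poly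
  have := congrArg (fun q => q.coeff B.p.natDegree) hp
  simpa [coeff_polyOf] using this

namespace Chain

variable {n : ℕ} {M : Matrix (Fin n) (Fin n) F} {bs : List (Block F)} {Y : ℕ → Fin n → F}

theorem blockEnd_lt (hY : Chain M bs Y) {i : ℕ} (hi : i < bs.length) :
    blockEnd bs i < blockEnd bs (i + 1) := by
  rw [blockEnd_succ hi]
  exact Nat.lt_add_of_pos_right (hY i hi).pos

theorem vecMul_last (hY : Chain M bs Y) {i : ℕ} (hi : i < bs.length) :
    Matrix.vecMul (Y (blockEnd bs (i + 1) - 1)) M = comb Y (blockEnd bs (i + 1)) bs[i].b := by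
  have h := hY i hi
  have hpos := h.pos
  rw [blockEnd_succ hi, comb_apply, ← h.last, Nat.add_sub_assoc hpos, h.shift _ (by omega),
    Matrix.vecMul_vecMul, ← pow_succ, Nat.sub_add_cancel hpos]

/-- The second stage of `mulM'` adds the images of the last rows of the blocks. -/
theorem comb_foldlM_mulM' (hY : Chain M bs Y) {z : ℕ} (hz : z ≤ bs.length) (w y : ℕ → F) (i : ℕ)
    (hi : i ≤ z) :
    comb Y (blockEnd bs z) ((bs.take i).zipIdx.foldlM (m := Cost)
      (fun (y : ℕ → F) (Br : Block F × ℕ) => do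
        let s := blockEnd bs (Br.2 + 1)
        let t ← tabUpTo s fun j => addMul (y j) (w (s - 1)) (Br.1.b j)
        pure fun j => if j < s then t j else y j) y).val =
      comb Y (blockEnd bs z) y + ∑ l ∈ Finset.range i,
        w (blockEnd bs (l + 1) - 1) • Matrix.vecMul (Y (blockEnd bs (l + 1) - 1)) M := by
  induction i with
  | zero => simp
  | succ i ih =>
    have hi' : i < bs.length := by omega
    rw [Finset.sum_range_succ, ← add_assoc, ← ih (by omega), hY.vecMul_last hi',
      ← comb_indicator Y (blockEnd_mono bs hi), ← map_smul, ← map_add, List.take_add_one,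
      List.getElem?_eq_getElem hi', List.zipIdx_append, val_foldlM, val_foldlM, List.foldl_append]
    apply comb_congr
    intro j hj
    simp only [List.length_take, Nat.min_eq_left hi'.le, Option.toList_some, List.zipIdx_cons,
      List.zipIdx_nil, List.foldl_cons, List.foldl_nil, val_bind, val_pure, val_tabUpTo,
      val_addMul, Pi.add_apply, Pi.smul_apply, smul_eq_mul, zero_add]
    split_ifs <;> simp

open Classical in
/-- `M'` is a shift within each block, corrected by the last row of each block. -/
theorem comb_vecMul (hY : Chain M bs Y) (w : ℕ → F) (z : ℕ) (hz : z ≤ bs.length) :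
    Matrix.vecMul (comb Y (blockEnd bs z) w) M =
      comb Y (blockEnd bs z) (fun j => if ∀ i, j ≠ blockEnd bs i then w (j - 1) else 0) +
        ∑ l ∈ Finset.range z,
          w (blockEnd bs (l + 1) - 1) • Matrix.vecMul (Y (blockEnd bs (l + 1) - 1)) M := by
  induction z with
  | zero => simp [blockEnd_zero, comb_apply]
  | succ z ih =>
    have h := hY z hz
    have hiff := fun t => ne_blockEnd_iff (t := t) hz
    obtain ⟨e, he⟩ : ∃ e, bs[z].p.natDegree = e + 1 := ⟨_, (Nat.sub_add_cancel h.pos).symm⟩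
    have hshift := h.shift
    rw [he] at hshift hiff
    have hstep : ∀ t < e,
        Matrix.vecMul (Y (blockEnd bs z + t)) M = Y (blockEnd bs z + (t + 1)) := by
      intro t ht
      rw [hshift t (by omega), hshift (t + 1) (by omega), Matrix.vecMul_vecMul, pow_succ]
    rw [Finset.sum_range_succ, blockEnd_succ hz, comb_add_range, comb_add_range,
      Matrix.add_vecMul, ih (by omega), Matrix.sum_vecMul, he, Finset.sum_range_succ,
      Finset.sum_range_succ' _ e]
    have h1 : ∑ t ∈ Finset.range e, Matrix.vecMul (w (blockEnd bs z + t) • Y (blockEnd bs z + t)) M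
        = ∑ t ∈ Finset.range e, (if ∀ i, blockEnd bs z + (t + 1) ≠ blockEnd bs i then
            w (blockEnd bs z + (t + 1) - 1) else 0) • Y (blockEnd bs z + (t + 1)) := by
      refine Finset.sum_congr rfl fun t ht => ?_
      have ht := Finset.mem_range.1 ht
      rw [Matrix.smul_vecMul, hstep t ht, if_pos ((hiff (t + 1) (by omega)).2 (by omega))]
      rfl
    rw [h1, if_neg (mt (hiff 0 (by omega)).1 (by simp)), zero_smul, add_zero,
      Matrix.smul_vecMul]
    simp only [← add_assoc, Nat.add_sub_cancel]
    abel

/-- In the coordinates with respect to `Y`, the operation `mulM'` is multiplication by `M`. -/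
theorem comb_mulM' (hY : Chain M bs Y) {z : ℕ} (hz : z ≤ bs.length) (w : ℕ → F) :
    comb Y (blockEnd bs z) (mulM' bs z w).val = Matrix.vecMul (comb Y (blockEnd bs z) w) M := by
  classical
  rw [mulM', hY.comb_foldlM_mulM' hz w _ z le_rfl, hY.comb_vecMul w z hz]
  congr 1
  apply comb_congr
  intro j hj
  have hiff : (j < blockEnd bs z ∧ ∀ i ≤ z, j ≠ blockEnd bs i) ↔ ∀ i, j ≠ blockEnd bs i := by
    refine ⟨fun h i => ?_, fun h => ⟨hj, fun i _ => h i⟩⟩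
    rcases le_total i z with hi | hi
    · exact h.2 i hi
    · exact (hj.trans_le (blockEnd_mono bs hi)).ne
  simp only [hiff]

theorem comb_applyPolyLoop (hY : Chain M bs Y) {z : ℕ} (hz : z ≤ bs.length) (d : ℕ) :
    ∀ (c : ℕ → F) (w y : ℕ → F),
      comb Y (blockEnd bs z) (applyPolyLoop bs z ((List.range d).map c) w y).val =
        comb Y (blockEnd bs z) y + Matrix.vecMul (comb Y (blockEnd bs z) w)
          (∑ r ∈ Finset.range d, c r • M ^ (r + 1)) := by
  induction d with
  | zero => intro c w y; simp [applyPolyLoop]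
  | succ d ih =>
    intro c w y
    have hy : comb Y (blockEnd bs z) (tabUpTo (blockEnd bs z) fun j =>
        addMul (y j) (c 0) ((mulM' bs z w).val j)).val =
        comb Y (blockEnd bs z) y + c 0 • Matrix.vecMul (comb Y (blockEnd bs z) w) M := by
      rw [← hY.comb_mulM' hz, ← map_smul, ← map_add]
      apply comb_congr
      intro j hj
      simp [hj]
    simp only [List.range_succ_eq_map, List.map_cons, List.map_map, applyPolyLoop, val_bind]
    rw [ih, hy, hY.comb_mulM' hz, Finset.sum_range_succ', Matrix.vecMul_add,
      Matrix.vecMul_vecMul, Finset.mul_sum, Matrix.vecMul_smul, zero_add, pow_one]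
    simp only [Function.comp_apply, Matrix.mul_smul, ← pow_succ', Nat.succ_eq_add_one]
    abel

theorem comb_applyPoly (hY : Chain M bs Y) {z : ℕ} (hz : z ≤ bs.length) (q : F[X]) (w : ℕ → F) :
    comb Y (blockEnd bs z) (applyPoly bs z q w).val =
      Matrix.vecMul (comb Y (blockEnd bs z) w) (aeval M q) := by
  have hy : comb Y (blockEnd bs z) (tabUpTo (blockEnd bs z) fun j => mul (q.coeff 0) (w j)).val =
      q.coeff 0 • comb Y (blockEnd bs z) w := by
    rw [← map_smul]
    apply comb_congr
    intro j hj
    simp [hj]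
  rw [applyPoly, val_bind, hY.comb_applyPolyLoop hz, hy, aeval_eq_sum_range,
    Finset.sum_range_succ', Matrix.vecMul_add, pow_zero, Matrix.vecMul_smul, Matrix.vecMul_one,
    add_comm]

theorem comb_applyFactorised (hY : Chain M bs Y) {z : ℕ} (hz : z ≤ bs.length) (g : Factorised F)
    (w : ℕ → F) : comb Y (blockEnd bs z) (applyFactorised bs z g w).val =
      Matrix.vecMul (comb Y (blockEnd bs z) w) (aeval M g.value) := by
  have hprod : (g.support.toList.flatMap fun q => List.replicate (g q) q).prod = g.value := by
    rw [List.flatMap, List.prod_flatten, List.map_map, Factorised.value, Finsupp.prod,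
      ← Finset.prod_map_toList]
    congr 2
    ext q
    simp
  rw [← hprod, applyFactorised]
  generalize (g.support.toList.flatMap fun q => List.replicate (g q) q) = l
  induction l generalizing w with
  | nil => simp
  | cons q l ih =>
    rw [List.foldlM_cons, val_bind, ih, hY.comb_applyPoly hz, Matrix.vecMul_vecMul, List.prod_cons,
      map_mul]

end Chain

/-! ### Order polynomials -/

namespace CyclicBasis

variable {n : ℕ} {M : Matrix (Fin n) (Fin n) F} {bs : List (Block F)} {Y : ℕ → Fin n → F}

theorem blockEnd_le (hY : CyclicBasis M bs Y) {i : ℕ} (hi : i ≤ bs.length) : blockEnd bs i ≤ n :=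
  (blockEnd_mono bs hi).trans_eq hY.blockEnd_eq

/-- By independence of the rows, a vector in the span of the first `m` rows has no other non-zero
coordinates. -/
theorem eq_zero_of_comb_mem (hY : CyclicBasis M bs Y) {m m' : ℕ} (hm : m ≤ m') (hm' : m' ≤ n)
    {w : ℕ → F} (h : comb Y m' w ∈ LinearMap.range (comb Y m)) (j : ℕ) (hj : m ≤ j)
    (hj' : j < m') : w j = 0 := by
  obtain ⟨w', h⟩ := h
  rw [← comb_indicator Y hm', ← comb_indicator Y (hm.trans hm'), ← sub_eq_zero, ← map_sub,
    comb_apply] at h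
  simpa [hj', hj.not_gt] using hY.indep _ h j (by omega)

theorem comb_eq_of_mem (hY : CyclicBasis M bs Y) {m m' : ℕ} (hm : m ≤ m') (hm' : m' ≤ n)
    {w : ℕ → F} (h : comb Y m' w ∈ LinearMap.range (comb Y m)) : comb Y m w = comb Y m' w := by
  rw [← comb_indicator Y hm]
  apply comb_congr
  intro j hj
  split_ifs with hlt
  · rfl
  · exact (hY.eq_zero_of_comb_mem hm hm' h j (not_lt.1 hlt) hj).symm

theorem vecMul_aeval_mem (hY : CyclicBasis M bs Y) {z : ℕ} (hz : z ≤ bs.length) (u : F[X])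
    {x : Fin n → F} (hx : x ∈ LinearMap.range (comb Y (blockEnd bs z))) :
    Matrix.vecMul x (aeval M u) ∈ LinearMap.range (comb Y (blockEnd bs z)) := by
  obtain ⟨w, rfl⟩ := hx
  exact ⟨_, hY.chain.comb_applyPoly hz u w⟩

/-- The polynomial of a block is the relative order polynomial of its first vector. -/
theorem vecMul_aeval_mem_iff (hY : CyclicBasis M bs Y) {i : ℕ} (hi : i < bs.length) (u : F[X]) :
    Matrix.vecMul (Y (blockEnd bs i)) (aeval M u) ∈ LinearMap.range (comb Y (blockEnd bs i)) ↔
      bs[i].p ∣ u := by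
  have hB := hY.chain i hi
  have hmem : ∀ v, Matrix.vecMul (Y (blockEnd bs i)) (aeval M (bs[i].p * v)) ∈
      LinearMap.range (comb Y (blockEnd bs i)) := by
    intro v
    rw [map_mul, ← Matrix.vecMul_vecMul, hB.vecMul_aeval_p]
    exact hY.vecMul_aeval_mem hi.le v ⟨_, rfl⟩
  constructor
  · intro h
    rw [← modByMonic_eq_zero_iff_dvd hB.monic]
    have hr : Matrix.vecMul (Y (blockEnd bs i)) (aeval M (u %ₘ bs[i].p)) ∈
        LinearMap.range (comb Y (blockEnd bs i)) := by
      rw [modByMonic_eq_sub_mul_div, map_sub, Matrix.vecMul_sub]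
      exact Submodule.sub_mem _ h (hmem _)
    have hdeg : (u %ₘ bs[i].p).natDegree < bs[i].p.natDegree :=
      natDegree_modByMonic_lt u hB.monic fun h1 => by
        have := hB.pos
        rw [h1, natDegree_one] at this
        omega
    generalize u %ₘ bs[i].p = r at hr hdeg
    have hpoly : r = polyOf bs[i].p.natDegree r.coeff := by
      ext m
      rw [coeff_polyOf]
      split_ifs with hm
      · rfl
      · exact coeff_eq_zero_of_natDegree_lt (by omega)
    rw [hpoly, hB.vecMul_aeval_polyOf] at hr
    have hcomb : comb Y (blockEnd bs (i + 1)) (fun j => if blockEnd bs i ≤ j then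
        r.coeff (j - blockEnd bs i) else 0) ∈ LinearMap.range (comb Y (blockEnd bs i)) := by
      rw [blockEnd_succ hi, comb_add_range]
      refine Submodule.add_mem _ ⟨_, rfl⟩ ?_
      simpa using hr
    have hz := hY.eq_zero_of_comb_mem (blockEnd_le_succ bs i) (hY.blockEnd_le hi) hcomb
    ext m
    rw [coeff_zero]
    rcases lt_or_ge m bs[i].p.natDegree with hm | hm
    · simpa using hz (blockEnd bs i + m) (Nat.le_add_right _ _) (by rw [blockEnd_succ hi]; omega)
    · exact coeff_eq_zero_of_natDegree_lt (by omega)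
  · rintro ⟨v, rfl⟩
    exact hmem v

/-- Modulo the span of the earlier rows, a vector is the image of the first vector of the block
under the polynomial `h` read off its coordinates in the block. -/
theorem comb_vecMul_aeval_mem_iff (hY : CyclicBasis M bs Y) {i : ℕ} (hi : i < bs.length)
    (v : ℕ → F) (u : F[X]) :
    Matrix.vecMul (comb Y (blockEnd bs (i + 1)) v) (aeval M u) ∈
        LinearMap.range (comb Y (blockEnd bs i)) ↔
      bs[i].p ∣ u * polyOf bs[i].p.natDegree (fun t => v (blockEnd bs i + t)) := by
  rw [← hY.vecMul_aeval_mem_iff hi, blockEnd_succ hi, comb_add_range,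
    ← (hY.chain i hi).vecMul_aeval_polyOf (fun t => v (blockEnd bs i + t)), Matrix.add_vecMul,
    Matrix.vecMul_vecMul, ← map_mul, mul_comm u]
  exact Submodule.add_mem_iff_right _ (hY.vecMul_aeval_mem hi.le u ⟨_, rfl⟩)

theorem val_ordPoly_succ [DecidableEq F] (bs : List (Block F)) (fs : List (Factorised F)) (i : ℕ)
    (v : ℕ → F) {d : ℕ} (hd : blockEnd bs (i + 1) - blockEnd bs i = d) {h : ℕ → F}
    (hh : h = fun j => if j < d then v (blockEnd bs i + j) else 0) :
    (ordPoly bs fs (i + 1) v).val = if ∀ j < d, h j = 0 then (ordPoly bs fs i v).val else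
      (divGcd (fs.getD i 0) d h).val :: (ordPoly bs fs i
        (if 0 < i then applyFactorised bs (i + 1) (divGcd (fs.getD i 0) d h).val v
          else pure v).val).val := by
  subst hd hh
  simp only [ordPoly]
  split_ifs <;> rfl

/-- `ordPoly` computes the order polynomial: in the step for a block, `u` maps the vector into
the span of the earlier rows exactly if the recorded polynomial `g` divides `u`, and then the
cofactor of `g` has to annihilate the image of the vector under `g`. -/
theorem ordPoly_spec [DecidableEq F] (hY : CyclicBasis M bs Y) {fs : List (Factorised F)}
    (hfs : ∀ i (hi : i < bs.length), (fs.getD i 0).IsIrred ∧ (fs.getD i 0).value = bs[i].p)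
    (i : ℕ) (hi : i ≤ bs.length) (v : ℕ → F) :
    (ordPoly bs fs i v).val.sum.IsIrred ∧
      ∀ u, Matrix.vecMul (comb Y (blockEnd bs i) v) (aeval M u) = 0 ↔
        (ordPoly bs fs i v).val.sum.value ∣ u := by
  induction i generalizing v with
  | zero =>
    simp [ordPoly, Factorised.isIrred_zero, Factorised.value_zero, blockEnd_zero, comb_apply]
  | succ i ih =>
    have hd : blockEnd bs (i + 1) - blockEnd bs i = bs[i].p.natDegree := by
      rw [blockEnd_succ hi]; omega
    have hle := blockEnd_le_succ bs i
    have hn := hY.blockEnd_le hi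
    obtain ⟨h, hh⟩ : ∃ h : ℕ → F, h = fun j => if j < bs[i].p.natDegree then
      v (blockEnd bs i + j) else 0 := ⟨_, rfl⟩
    rw [val_ordPoly_succ bs fs i v hd hh]
    by_cases h0 : ∀ j < bs[i].p.natDegree, h j = 0
    · rw [if_pos h0]
      have hv : comb Y (blockEnd bs (i + 1)) v = comb Y (blockEnd bs i) v := by
        rw [blockEnd_succ hi, comb_add_range, add_eq_left]
        refine Finset.sum_eq_zero fun t ht => ?_
        have := h0 t (Finset.mem_range.1 ht)
        rw [hh] at this
        simp only [Finset.mem_range.1 ht, if_true] at this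
        rw [this, zero_smul]
      rw [hv]
      exact ih (by omega) v
    · rw [if_neg h0]
      rw [List.sum_cons]
      obtain ⟨hirr, hval⟩ := hfs i hi
      have hg : ∀ u, Matrix.vecMul (comb Y (blockEnd bs (i + 1)) v) (aeval M u) ∈
          LinearMap.range (comb Y (blockEnd bs i)) ↔
          (divGcd (fs.getD i 0) bs[i].p.natDegree h).val.value ∣ u := by
        intro u
        rw [hY.comb_vecMul_aeval_mem_iff hi, value_divGcd_dvd_iff hirr, hval]
        · have : polyOf bs[i].p.natDegree h =
              polyOf bs[i].p.natDegree (fun t => v (blockEnd bs i + t)) := by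
            ext m
            rw [coeff_polyOf, coeff_polyOf, hh]
            split_ifs with hm
            · exact if_pos hm
            · rfl
          rw [this]
        · intro j hj
          rw [hh]
          exact if_neg (not_lt.2 hj)
      have hgirr : (divGcd (fs.getD i 0) bs[i].p.natDegree h).val.IsIrred :=
        hirr.mono (divGcd_le _ _ _)
      generalize (divGcd (fs.getD i 0) bs[i].p.natDegree h).val = g at hg hgirr
      obtain ⟨v', hv'⟩ : ∃ v', v' = (if 0 < i then applyFactorised bs (i + 1) g v
        else pure v).val := ⟨_, rfl⟩
      rw [← hv']
      have hcomb : comb Y (blockEnd bs i) v' =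
          Matrix.vecMul (comb Y (blockEnd bs (i + 1)) v) (aeval M g.value) := by
        have hmem := (hg g.value).2 dvd_rfl
        by_cases hi0 : 0 < i
        · rw [if_pos hi0] at hv'
          rw [← hY.chain.comb_applyFactorised hi, ← hv'] at hmem ⊢
          exact hY.comb_eq_of_mem hle hn hmem
        · obtain rfl : i = 0 := by omega
          obtain ⟨x, hx⟩ := hmem
          rw [← hx, blockEnd_zero, comb_apply, comb_apply]
          rfl
      obtain ⟨ih1, ih2⟩ := ih (by omega) v'
      refine ⟨hgirr.add ih1, fun u => ?_⟩
      rw [Factorised.value_add]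
      constructor
      · intro hu
        obtain ⟨r, rfl⟩ := (hg u).1 (hu ▸ Submodule.zero_mem _)
        refine mul_dvd_mul_left _ ((ih2 r).1 ?_)
        rw [hcomb, Matrix.vecMul_vecMul, ← map_mul, hu]
      · rintro ⟨r, rfl⟩
        rw [mul_assoc, map_mul, ← Matrix.vecMul_vecMul, ← hcomb]
        exact (ih2 _).2 (dvd_mul_right _ _)

end CyclicBasis

/-! ### Costs -/

theorem cost_mulM'_le (bs : List (Block F)) {z : ℕ} (hz : z ≤ bs.length) (w : ℕ → F) :
    (mulM' bs z w).cost ≤ 2 * ∑ j ∈ Finset.range z, blockEnd bs (j + 1) := by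
  refine (cost_foldlM_le _ (fun Br => 2 * blockEnd bs (Br.2 + 1)) _ ?_ _).trans (le_of_eq ?_)
  · rintro Br - y
    simp [mul_comm]
  · rw [← Function.comp_def (fun i => 2 * blockEnd bs (i + 1)) Prod.snd, ← List.map_map,
      List.zipIdx_map_snd, List.length_take, Nat.min_eq_left hz, ← List.range_eq_range',
      Finset.mul_sum]
    rfl

theorem cost_applyPolyLoop_le (bs : List (Block F)) {z : ℕ} (hz : z ≤ bs.length) (cs : List F) :
    ∀ w y : ℕ → F, (applyPolyLoop bs z cs w y).cost ≤ cs.length *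
      (2 * ∑ j ∈ Finset.range z, blockEnd bs (j + 1) + 2 * blockEnd bs z) := by
  induction cs with
  | nil => intro w y; simp [applyPolyLoop]
  | cons c cs ih =>
    intro w y
    simp only [applyPolyLoop, cost_bind, cost_tabUpTo, cost_addMul, Finset.sum_const,
      Finset.card_range, smul_eq_mul, List.length_cons]
    have h1 := cost_mulM'_le bs hz w
    have h2 := ih (mulM' bs z w).val (tabUpTo (blockEnd bs z) fun j =>
      addMul (y j) c ((mulM' bs z w).val j)).val
    rw [add_mul, one_mul]
    omega

/-- The initial scaling by the constant coefficient costs one multiple of the block end, which is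
paid for by the positive degree of `q`. -/
theorem cost_applyPoly_le (bs : List (Block F)) {z : ℕ} (hz : z ≤ bs.length) (q : F[X])
    (hq : 0 < q.natDegree) (w : ℕ → F) :
    (applyPoly bs z q w).cost ≤ q.natDegree *
      (3 * blockEnd bs z + 2 * ∑ j ∈ Finset.range z, blockEnd bs (j + 1)) := by
  simp only [applyPoly, cost_bind, cost_tabUpTo, cost_mul, Finset.sum_const, Finset.card_range,
    smul_eq_mul, mul_one]
  have h1 := cost_applyPolyLoop_le bs hz ((List.range q.natDegree).map fun r => q.coeff (r + 1)) w
    (tabUpTo (blockEnd bs z) fun j => mul (q.coeff 0) (w j)).val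
  rw [List.length_map, List.length_range] at h1
  have h2 : blockEnd bs z ≤ q.natDegree * blockEnd bs z := Nat.le_mul_of_pos_left _ hq
  calc _ ≤ q.natDegree * blockEnd bs z + _ := Nat.add_le_add h2 h1
    _ = _ := by ring

theorem cost_applyFactorised_le (bs : List (Block F)) {z : ℕ} (hz : z ≤ bs.length)
    {g : Factorised F} (hg : g.IsIrred) (w : ℕ → F) :
    (applyFactorised bs z g w).cost ≤ g.deg *
      (3 * blockEnd bs z + 2 * ∑ j ∈ Finset.range z, blockEnd bs (j + 1)) := by
  refine (cost_foldlM_le _ (fun q => q.natDegree *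
      (3 * blockEnd bs z + 2 * ∑ j ∈ Finset.range z, blockEnd bs (j + 1))) _ ?_ _).trans
    (le_of_eq ?_)
  · intro q hq w
    obtain ⟨q', hq', hmem⟩ := List.mem_flatMap.1 hq
    obtain rfl := List.eq_of_mem_replicate hmem
    exact cost_applyPoly_le bs hz q (hg q (Finset.mem_toList.1 hq')).2.natDegree_pos w
  · rw [List.map_flatMap, List.flatMap, List.sum_flatten, List.map_map,
      Finset.sum_map_toList, Factorised.deg, Finsupp.sum, Finset.sum_mul]
    exact Finset.sum_congr rfl fun q _ => by simp [mul_assoc]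

/-- A bound for the cost of the step of `ordPoly` for block number `i`, in terms of the block ends
`s`: the trial divisions, followed by the application of a polynomial of degree at most `dᵢ`. -/
def stepCost (s : ℕ → ℕ) (i : ℕ) : ℕ :=
  (s (i + 1) - s i) * (2 * (s (i + 1) - s i)) +
    (s (i + 1) - s i) * (3 * s (i + 1) + 2 * ∑ j ∈ Finset.range (i + 1), s (j + 1))

theorem cost_ordPoly_le [DecidableEq F] (bs : List (Block F)) (fs : List (Factorised F))
    (hfs : ∀ i < bs.length, (fs.getD i 0).IsIrred ∧
      (fs.getD i 0).deg = blockEnd bs (i + 1) - blockEnd bs i)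
    (i : ℕ) (hi : i ≤ bs.length) (v : ℕ → F) :
    (ordPoly bs fs i v).cost ≤ ∑ l ∈ Finset.range i, stepCost (blockEnd bs) l := by
  induction i generalizing v with
  | zero => simp [ordPoly]
  | succ i ih =>
    obtain ⟨hirr, hdeg⟩ := hfs i hi
    rw [Finset.sum_range_succ, stepCost]
    simp only [ordPoly]
    split_ifs with h0 hi0
    · exact (ih (by omega) v).trans (Nat.le_add_right _ _)
    all_goals
      obtain ⟨h, hh⟩ : ∃ h : ℕ → F, h = fun j => if j < blockEnd bs (i + 1) - blockEnd bs i then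
        v (blockEnd bs i + j) else 0 := ⟨_, rfl⟩
      rw [← hh]
      have h1 := cost_divGcd_le (fs.getD i 0) (blockEnd bs (i + 1) - blockEnd bs i) h
      have h2 := divGcd_le (fs.getD i 0) (blockEnd bs (i + 1) - blockEnd bs i) h
      rw [hdeg] at h1
      simp only [cost_bind, cost_pure, val_pure, zero_add, add_zero]
    · have h3 := cost_applyFactorised_le bs hi (hirr.mono h2) v
      have h4 := ih (by omega) (applyFactorised bs (i + 1)
        (divGcd (fs.getD i 0) (blockEnd bs (i + 1) - blockEnd bs i) h).val v).val
      have h5 := h3.trans (Nat.mul_le_mul_right _ ((Factorised.deg_mono h2).trans_eq hdeg))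
      omega
    · have h4 := ih (by omega) v
      omega

section stepCost

variable {s : ℕ → ℕ}

theorem sum_sub_mul_le (hs : Monotone s) (k : ℕ) :
    ∑ i ∈ Finset.range k, (s (i + 1) - s i) * s (i + 1) ≤ s k * s k := by
  induction k with
  | zero => simp
  | succ k ih =>
    rw [Finset.sum_range_succ]
    obtain ⟨d, hd⟩ := Nat.exists_eq_add_of_le (hs (Nat.le_succ k))
    rw [Nat.succ_eq_add_one] at hd
    rw [hd, Nat.add_sub_cancel_left]
    nlinarith

theorem sum_sub_mul_two_le (hs : Monotone s) (k : ℕ) :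
    ∑ i ∈ Finset.range k, (s (i + 1) - s i) * (2 * s i) ≤ s k * s k := by
  induction k with
  | zero => simp
  | succ k ih =>
    rw [Finset.sum_range_succ]
    obtain ⟨d, hd⟩ := Nat.exists_eq_add_of_le (hs (Nat.le_succ k))
    rw [Nat.succ_eq_add_one] at hd
    rw [hd, Nat.add_sub_cancel_left]
    nlinarith

theorem sum_sum_range_eq (D : ℕ → ℕ) (k : ℕ) :
    ∑ z ∈ Finset.range k, ∑ l ∈ Finset.range (z + 1), D l =
      ∑ i ∈ Finset.range k, (k - i) * D i := by
  induction k with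
  | zero => simp
  | succ k ih =>
    rw [Finset.sum_range_succ, ih, Finset.sum_range_succ, Finset.sum_range_succ, ← add_assoc,
      ← Finset.sum_add_distrib]
    congr 1
    · refine Finset.sum_congr rfl fun i hi => ?_
      rw [Nat.succ_sub (Finset.mem_range.1 hi).le, Nat.succ_mul]
    · simp

/-- The step for block `i` is performed in `k - i` of the calls of `ordPoly`. Its main part is
bounded by `2 dᵢ i sᵢ`, where `(k - i) i ≤ k² / 4` and `∑ 2 dᵢ sᵢ ≤ n²`. -/
theorem sum_stepCost_le (hs : Monotone s) (k : ℕ) :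
    4 * ∑ z ∈ Finset.range k, ∑ l ∈ Finset.range (z + 1), stepCost s l ≤
      k * k * (s k * s k) + 28 * k * (s k * s k) := by
  rw [sum_sum_range_eq, Finset.mul_sum]
  have hstep : ∀ i ∈ Finset.range k, 4 * ((k - i) * stepCost s i) ≤
      k * k * ((s (i + 1) - s i) * (2 * s i)) + 28 * k * ((s (i + 1) - s i) * s (i + 1)) := by
    intro i hi
    obtain ⟨e, rfl⟩ := Nat.exists_eq_add_of_le (Finset.mem_range.1 hi).le
    have hsum : ∑ j ∈ Finset.range i, s (j + 1) ≤ i * s i := by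
      simpa using Finset.sum_le_card_nsmul (Finset.range i) (fun j => s (j + 1)) (s i)
        fun j hj => hs (Finset.mem_range.1 hj)
    have hd : s (i + 1) - s i ≤ s (i + 1) := Nat.sub_le _ _
    rw [stepCost, Finset.sum_range_succ, Nat.add_sub_cancel_left]
    generalize s (i + 1) - s i = d at hd ⊢
    generalize ∑ j ∈ Finset.range i, s (j + 1) = m at hsum ⊢
    have h1 : d * (2 * d) + d * (3 * s (i + 1) + 2 * (m + s (i + 1))) ≤
        7 * (d * s (i + 1)) + 2 * (d * (i * s i)) := by
      have h2 := Nat.mul_le_mul_left d hd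
      have h3 := Nat.mul_le_mul_left d hsum
      nlinarith
    have h4 : 4 * (e * i) ≤ (i + e) * (i + e) := by
      zify
      nlinarith [sq_nonneg ((i : ℤ) - e)]
    calc _ ≤ 4 * (e * (7 * (d * s (i + 1)) + 2 * (d * (i * s i)))) := by gcongr
      _ = 4 * (e * i) * (d * (2 * s i)) + 28 * e * (d * s (i + 1)) := by ring
      _ ≤ (i + e) * (i + e) * (d * (2 * s i)) + 28 * (i + e) * (d * s (i + 1)) := by
        gcongr
        omega
  refine (Finset.sum_le_sum hstep).trans ?_
  rw [Finset.sum_add_distrib, ← Finset.mul_sum, ← Finset.mul_sum]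
  exact Nat.add_le_add (Nat.mul_le_mul_left _ (sum_sub_mul_two_le hs k))
    (Nat.mul_le_mul_left _ (sum_sub_mul_le hs k))

end stepCost

/-! ### The minimal polynomial -/

theorem Factorised.foldr_lcm_spec (fs : List (Factorised F)) (h : ∀ f ∈ fs, f.IsIrred) :
    (fs.foldr Factorised.lcm 0).IsIrred ∧
      ∀ u, (fs.foldr Factorised.lcm 0).value ∣ u ↔ ∀ f ∈ fs, f.value ∣ u := by
  induction fs with
  | nil => simp [Factorised.isIrred_zero, Factorised.value_zero]
  | cons f fs ih =>
    obtain ⟨h1, h2⟩ := ih fun g hg => h g (by simp [hg])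
    have hf := h f (by simp)
    refine ⟨hf.lcm h1, fun u => ?_⟩
    rw [List.foldr_cons, hf.value_lcm_dvd_iff h1, h2]
    simp

theorem Factorised.foldl_lcm_spec {ι : Type*} (l : List ι) (G : ι → Factorised F)
    (h : ∀ i ∈ l, (G i).IsIrred) (f : Factorised F) (hf : f.IsIrred) :
    (l.foldl (fun f i => f.lcm (G i)) f).IsIrred ∧
      ∀ u, (l.foldl (fun f i => f.lcm (G i)) f).value ∣ u ↔
        f.value ∣ u ∧ ∀ i ∈ l, (G i).value ∣ u := by
  induction l generalizing f with
  | nil => simp [hf]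
  | cons i l ih =>
    have hi := h i (by simp)
    obtain ⟨h1, h2⟩ := ih (fun j hj => h j (by simp [hj])) _ (hf.lcm hi)
    refine ⟨h1, fun u => ?_⟩
    rw [List.foldl_cons, h2, hf.value_lcm_dvd_iff hi]
    simp [and_assoc]

namespace CyclicBasis

variable {n : ℕ} {M : Matrix (Fin n) (Fin n) F} {bs : List (Block F)} {Y : ℕ → Fin n → F}

/-- A matrix polynomial vanishes if it annihilates the first vector of each block. -/
theorem aeval_eq_zero (hY : CyclicBasis M bs Y) (u : F[X])
    (h : ∀ i < bs.length, Matrix.vecMul (Y (blockEnd bs i)) (aeval M u) = 0) :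
    aeval M u = 0 := by
  have hcomb : ∀ z ≤ bs.length, ∀ j < blockEnd bs z, Matrix.vecMul (Y j) (aeval M u) = 0 := by
    intro z
    induction z with
    | zero => intro _ j hj; simp [blockEnd_zero] at hj
    | succ z ih =>
      intro hz j hj
      rcases lt_or_ge j (blockEnd bs z) with hlt | hge
      · exact ih (by omega) j hlt
      · obtain ⟨t, rfl⟩ := Nat.exists_eq_add_of_le hge
        rw [blockEnd_succ hz] at hj
        have hcomm : M ^ t * aeval M u = aeval M u * M ^ t := by
          have hX : M ^ t = aeval M (X ^ t : F[X]) := by rw [map_pow, aeval_X]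
          rw [hX, ← map_mul, ← map_mul, mul_comm]
        rw [(hY.chain z hz).shift t (by omega), Matrix.vecMul_vecMul, hcomm,
          ← Matrix.vecMul_vecMul, h z hz, Matrix.zero_vecMul]
  let A : Matrix (Fin n) (Fin n) F := fun i => Y i
  have hA : IsUnit A := by
    rw [← Matrix.linearIndependent_rows_iff_isUnit, Fintype.linearIndependent_iff]
    intro g hg i
    have := hY.indep (fun j => if h : j < n then g ⟨j, h⟩ else 0) (by
      rw [Finset.sum_range, ← hg]
      refine Finset.sum_congr rfl fun i _ => ?_
      simp [A, Matrix.row]) i i.2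
    simpa using this
  have hmul : A * aeval M u = 0 := by
    ext i j
    have := congrFun (hcomb bs.length le_rfl i (i.2.trans_eq hY.blockEnd_eq.symm)) j
    exact this
  exact hA.mul_right_eq_zero.1 hmul

theorem comb_single (hY : CyclicBasis M bs Y) {i : ℕ} (hi : i < bs.length) :
    comb Y (blockEnd bs (i + 1)) (fun j => if j = blockEnd bs i then 1 else 0) =
      Y (blockEnd bs i) := by
  rw [comb_apply, Finset.sum_eq_single (blockEnd bs i)]
  · simp
  · intro j _ hj
    simp [hj]
  · intro h
    exact absurd (Finset.mem_range.2 (hY.chain.blockEnd_lt hi)) h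

end CyclicBasis

/-- The polynomial of a block divides every polynomial annihilating `M`, and the order polynomials
of the first vectors of the blocks together test whether a polynomial annihilates `M`. For the first
block, its own polynomial is already the order polynomial, so the loop can start with the second. -/
theorem value_minPoly [DecidableEq F] {n : ℕ} {M : Matrix (Fin n) (Fin n) F}
    {bs : List (Block F)} {Y : ℕ → Fin n → F} (hY : CyclicBasis M bs Y)
    {fs : List (Factorised F)} (hlen : fs.length = bs.length)
    (hfs : ∀ i (hi : i < bs.length), (fs.getD i 0).IsIrred ∧ (fs.getD i 0).value = bs[i].p) :
    ((List.range' 2 (bs.length - 1)).foldl (fun f i => f.lcm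
      (ordPoly bs fs i (fun j => if j = blockEnd bs (i - 1) then 1 else 0)).val.sum)
      (fs.foldr Factorised.lcm 0)).value = minpoly F M := by
  have hget : ∀ f ∈ fs, ∃ i, ∃ hi : i < bs.length, f = fs.getD i 0 := by
    intro f hf
    obtain ⟨i, hi, rfl⟩ := List.getElem_of_mem hf
    exact ⟨i, hlen ▸ hi, by simp [hi]⟩
  obtain ⟨hirr₀, hdvd₀⟩ := Factorised.foldr_lcm_spec fs fun f hf => by
    obtain ⟨i, hi, rfl⟩ := hget f hf
    exact (hfs i hi).1
  obtain ⟨hirr, hdvd⟩ := Factorised.foldl_lcm_spec (List.range' 2 (bs.length - 1))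
    (fun i => (ordPoly bs fs i (fun j => if j = blockEnd bs (i - 1) then 1 else 0)).val.sum)
    (fun i hi => (hY.ordPoly_spec hfs i (by rw [List.mem_range'_1] at hi; omega) _).1) _ hirr₀
  have key : ∀ u, _ ↔ aeval M u = 0 := fun u => (hdvd u).trans (by
    rw [hdvd₀]
    constructor
    · rintro ⟨h1, h2⟩
      refine hY.aeval_eq_zero u fun i hi => ?_
      rcases Nat.eq_zero_or_pos i with rfl | hpos
      · -- The space spanned by the rows before the first block is zero.
        have hp : bs[0].p ∣ u := by
          rw [← (hfs 0 hi).2]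
          refine h1 _ ?_
          rw [List.getD_eq_getElem _ _ (hlen.symm ▸ hi)]
          exact List.getElem_mem _
        obtain ⟨w, hw⟩ := (hY.vecMul_aeval_mem_iff hi u).2 hp
        rw [← hw, blockEnd_zero, comb_apply]
        rfl
      · have := h2 (i + 1) (by rw [List.mem_range'_1]; omega)
        rwa [← (hY.ordPoly_spec hfs (i + 1) hi _).2, Nat.add_sub_cancel, hY.comb_single hi]
          at this
    · intro hu
      constructor
      · intro f hf
        obtain ⟨i, hi, rfl⟩ := hget f hf
        rw [(hfs i hi).2, ← hY.vecMul_aeval_mem_iff hi, hu, Matrix.vecMul_zero]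
        exact Submodule.zero_mem _
      · intro i hi
        rw [List.mem_range'_1] at hi
        rw [← (hY.ordPoly_spec hfs i (by omega) _).2, hu, Matrix.vecMul_zero])
  refine eq_of_monic_of_associated hirr.value_monic (minpoly.monic (Matrix.isIntegral M)) ?_
  exact associated_of_dvd_dvd ((key _).2 (minpoly.aeval F M))
    (minpoly.dvd F M ((key _).1 dvd_rfl))

/-- The loop of the modified algorithm over `i = 2, …, k`. The bound also contains a summand for
`i = 1`. -/
theorem cost_minPoly_le [DecidableEq F] (bs : List (Block F)) (fs : List (Factorised F))
    (hfs : ∀ i < bs.length, (fs.getD i 0).IsIrred ∧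
      (fs.getD i 0).deg = blockEnd bs (i + 1) - blockEnd bs i)
    (v : ℕ → ℕ → F) (f : Factorised F) :
    ((List.range' 2 (bs.length - 1)).foldlM (m := Cost) (fun f i => do
      let g ← ordPoly bs fs i (v i)
      pure (f.lcm g.sum)) f).cost ≤
    ∑ z ∈ Finset.range bs.length, ∑ l ∈ Finset.range (z + 1), stepCost (blockEnd bs) l := by
  refine (cost_foldlM_le _ (fun z => ∑ l ∈ Finset.range z, stepCost (blockEnd bs) l) _
    ?_ _).trans ?_
  · intro i hi f
    rw [List.mem_range'_1] at hi
    simpa using cost_ordPoly_le bs fs hfs i (by omega) (v i)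
  · rcases bs.length with _ | m
    · simp
    · rw [Finset.sum_range_succ', Nat.add_sub_cancel, List.range'_eq_map_range, List.map_map]
      refine le_trans (le_of_eq ?_) (Nat.le_add_right _ _)
      change ∑ t ∈ Finset.range m, _ = _
      refine Finset.sum_congr rfl fun t _ => ?_
      simp only [Function.comp_apply, add_comm 2 t]

end MinPolyMC

end

open MinPolyMC in
theorem mainTheorem8 {F : Type*} [Field F] [Fintype F] [DecidableEq F]
    (factorise : List F[X] → MinPolyMC.Cost (List (MinPolyMC.Factorised F)))
    (hfactorise : MinPolyMC.FactorisesCorrectly factorise)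
    (ξ : ℕ → ℕ) (char fact : ℕ → ℕ → ℝ) (n : ℕ)
    (hchar : MinPolyMC.IsCharBound F n ξ (char n (Fintype.card F)))
    (hfact : MinPolyMC.IsFactBound factorise n (fact n (Fintype.card F)))
    (M : Matrix (Fin n) (Fin n) F) (ω : MinPolyMC.RandomOutcome F n)
    (hk : ((MinPolyMC.charPoly ξ ω M).val.1.length : ℝ) ≤ √(n : ℝ)) :
    (MinPolyMC.minPolyFull factorise ξ ω M).val.1 = true ∧
    (MinPolyMC.minPolyFull factorise ξ ω M).val.2.value = minpoly F M ∧
    ((MinPolyMC.minPolyFull factorise ξ ω M).cost : ℝ) ≤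
      char n (Fintype.card F) + fact n (Fintype.card F)
        + 1 / 4 * (n : ℝ) ^ 3 + 37 / 4 * (n : ℝ) ^ (5 / 2 : ℝ) := by
  obtain ⟨Y, hY⟩ := charPoly_spec ξ ω M
  have hcharM := hchar M ω
  simp only [minPolyFull, minPolyWith, val_bind, val_pure, cost_bind, cost_pure]
  generalize (charPoly ξ ω M).cost = cc at hcharM ⊢
  generalize (charPoly ξ ω M).val.1 = bs at hk hY ⊢
  have hmonic : ∀ p ∈ bs.map (fun B => B.p), p.Monic ∧ 0 < p.natDegree := by
    intro p hp
    obtain ⟨B, hB, rfl⟩ := List.mem_map.1 hp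
    obtain ⟨i, hi, rfl⟩ := List.getElem_of_mem hB
    exact ⟨(hY.chain i hi).monic, (hY.chain i hi).pos⟩
  have hsum : ((bs.map fun B => B.p).map natDegree).sum = n := by
    rw [← hY.blockEnd_eq, blockEnd, List.take_length, List.map_map]
    rfl
  have hfactM := hfact _ hmonic hsum
  have hfac := hfactorise _ hmonic
  generalize (factorise (bs.map fun B => B.p)).cost = cf at hfactM ⊢
  generalize (factorise (bs.map fun B => B.p)).val = fs at hfac ⊢
  have hlen : fs.length = bs.length := by simpa using hfac.length_eq.symm
  have hfs : ∀ i (hi : i < bs.length),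
      (fs.getD i 0).IsIrred ∧ (fs.getD i 0).value = bs[i].p := by
    intro i hi
    have := hfac.get (i := i) (by simpa using hi) (by omega)
    rw [List.getD_eq_getElem _ _ (by omega)]
    simpa [IsFactorisation, Factorised.IsIrred] using this
  have hdeg : ∀ i < bs.length, (fs.getD i 0).IsIrred ∧
      (fs.getD i 0).deg = blockEnd bs (i + 1) - blockEnd bs i := by
    intro i hi
    refine ⟨(hfs i hi).1, ?_⟩
    rw [← (hfs i hi).1.natDegree_value, (hfs i hi).2, blockEnd_succ hi, Nat.add_sub_cancel_left]
  refine ⟨by simp, ?_, ?_⟩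
  · rw [val_foldlM]
    exact value_minPoly hY hlen hfs
  · have h1 := cost_minPoly_le bs fs hdeg
      (fun i j => if j = blockEnd bs (i - 1) then 1 else 0) (fs.foldr Factorised.lcm 0)
    have h2 := sum_stepCost_le (blockEnd_mono bs) bs.length
    rw [hY.blockEnd_eq] at h2
    have h3 := (Nat.mul_le_mul_left 4 h1).trans h2
    generalize Cost.cost (List.foldlM _ _ _) = cl at h3 ⊢
    generalize bs.length = k at hk h3
    have h4 : (4 * cl : ℝ) ≤ k * k * (n * n) + 28 * k * (n * n) := by exact_mod_cast h3
    have hsq : √(n : ℝ) * √(n : ℝ) = n := Real.mul_self_sqrt (Nat.cast_nonneg n)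
    have hpow : (n : ℝ) ^ (5 / 2 : ℝ) = n * n * √(n : ℝ) := by
      rw [show (5 / 2 : ℝ) = (2 : ℕ) + 1 / 2 by norm_num,
        Real.rpow_add_of_nonneg (Nat.cast_nonneg n) (by positivity) (by norm_num),
        Real.rpow_natCast, Real.sqrt_eq_rpow, pow_two]
    have h5 : (k : ℝ) * k * (n * n) ≤ n ^ 3 := by
      calc (k : ℝ) * k * (n * n) ≤ √(n : ℝ) * √(n : ℝ) * (n * n) := by gcongr
        _ = n ^ 3 := by rw [hsq]; ring
    have h6 : (k : ℝ) * (n * n) ≤ n * n * √(n : ℝ) := by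
      calc (k : ℝ) * (n * n) ≤ √(n : ℝ) * (n * n) := by gcongr
        _ = _ := by ring
    have h7 : 0 ≤ (n : ℝ) * n * √(n : ℝ) := by positivity
    rw [hpow]
    push_cast
    linarith
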